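/- **Setting.** Let $\mathcal G=(\mathcal I,\mathcal E)$ be a connected undirected graph with $n\ge 2$ buses and $m\ge 1$ lines, with an arbitrary orientation of the lines and incidence matrix $D\in\mathbb R^{m\times n}$ ($d_{ki}=1$ if $i$ is the positive end of line $k$, $-1$ if it is the negative end, $0$ otherwise). Let $Y_b$ be the diagonal matrix of the line susceptances, which are positive, let $M_i,E_i>0$ be the inertia and damping coefficients of bus $i$, and $p\in\mathbb R^n$ the constant power injections. Put $$\omega^\infty=\frac{\sum_i p_i}{\sum_i E_i},\qquad \tilde p_i=p_i-\omega^\infty E_i,\qquad \Gamma=\{\lambda\in\mathbb R^m:|\lambda_j|<\pi/2\ \forall j\},\qquad \Gamma_{\rm cl}=\{\lambda\in\mathbb R^m:|\lambda_j|\le\pi/2\ \forall j\},$$ and let $\lambda^\infty\in\Gamma\cap\operatorname{range}(D)$ satisfy $\tilde p=D^TY_b\sin\lambda^\infty$ (componentwise sine). Define $$V(\lambda,\omega)=\tfrac12\sum_{i}M_i(\omega_i-\omega^\infty)^2+\sum_{j}[Y_b]_{jj}\bigl(\cos\lambda_j^\infty-\cos\lambda_j-\lambda_j\sin\lambda_j^\infty+\lambda_j^\infty\sin\lambda_j^\infty\bigr),$$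 $$c=\min_{\lambda\in\partial\Gamma_{\rm cl}}V(\lambda,\omega^\infty\mathbf 1),\qquad \Phi_\beta=\{(\lambda,\omega):\lambda\in\Gamma_{\rm cl},\ V(\lambda,\omega)\le c/\beta\}.$$ Let $\mathfrak C\subseteq\mathcal I$ be the set of controlled buses. For $i\in\mathfrak C$ let $\underline\omega_i<\underline\omega_i^{\rm th}<\bar\omega_i^{\rm th}<\bar\omega_i$, and let $\bar\alpha_i,\underline\alpha_i:\mathbb R\to\mathbb R$ be locally Lipschitz and of class $\mathcal K$ (continuous, strictly increasing, zero at zero). With $x=(\lambda,\omega)$ and $q_i(x,p)=E_i\omega_i+[D^TY_b\sin\lambda]_i-p_i$, put $$u_i(x,p)=\begin{cases}\min\Bigl\{0,\frac{-\bar\alpha_i(\omega_i-\bar\omega_i)}{\omega_i-\bar\omega_i^{\rm th}}+q_i(x,p)\Bigr\}&\omega_i>\bar\omega_i^{\rm th},\\ 0&\underline\omega_i^{\rm th}\le\omega_i\le\bar\omega_i^{\rm th},\\ \max\Bigl\{0,\frac{\underline\alpha_i(\underline\omega_i-\omega_i)}{\underline\omega_i^{\rm th}-\omega_i}+q_i(x,p)\Bigr\}&\omega_i<\underline\omega_i^{\rm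 th}.\end{cases}$$ The closed-loop system is $\dot\lambda=D\omega$, $M_i\dot\omega_i=-E_i\omega_i-[D^TY_b\sin\lambda]_i+p_i+u_i(x,p)$ for $i\in\mathfrak C$, and the same equation without $u_i$ for $i\notin\mathfrak C$. We say that a function $f$ on $[0,\infty)$ *monotonically approaches* $[a,b]$ if the distance from $f(t)$ to $[a,b]$ is nonincreasing in $t\ge0$ and tends to $0$ as $t\to\infty$. **Theorem.** Assume $\omega^\infty\in(\underline\omega_i^{\rm th},\bar\omega_i^{\rm th})$ for all $i\in\mathfrak C$. The equilibrium $(\lambda^\infty,\omega^\infty\mathbf 1)$ of the closed-loop system is Lyapunov stable. If $\lambda(0)\in\operatorname{range}(D)$ and $(\lambda(0),\omega(0))\in\Phi_\beta$ for some $\beta>1$, then: 1. the solution exists and is unique for all $t\ge0$; 2. $\lambda(t)\in\operatorname{range}(D)$ and $(\lambda(t),\omega(t))\in\Phi_\beta$ for all $t\ge 0$; 3. $(\lambda(t),\omega(t))\to(\lambda^\infty,\omega^\infty\mathbf 1)$ as $t\to\infty$; 4. there is $t_0>0$ such that $u_i(x(t),p)=0$ for all $t\ge t_0$ and all $i\in\mathfrak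 C$; 5. for each $i\in\mathfrak C$, if $\omega_i(0)\in[\underline\omega_i,\bar\omega_i]$, then $\omega_i(t)\in[\underline\omega_i,\bar\omega_i]$ for all $t>0$; 6. for each $i\in\mathfrak C$, if $\omega_i(0)\notin[\underline\omega_i,\bar\omega_i]$, then $\omega_i(t)$ monotonically approaches $[\underline\omega_i,\bar\omega_i]$, and there is $t_1>0$ such that $\omega_i(t)\in[\underline\omega_i,\bar\omega_i]$ for all $t\ge t_1$. Moreover, for every solution that exists for all $t\ge 0$, whether or not its initial state lies in some $\Phi_\beta$, statement 5 and the monotone approach in statement 6 still hold. -/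

import Mathlib

open Set Filter Topology

noncomputable section

/-- A function of class `𝒦` on the real line: continuous, strictly increasing, zero at zero. -/
structure IsClassK (α : ℝ → ℝ) : Prop where
  continuous : Continuous α
  strictMono : StrictMono α
  map_zero : α 0 = 0

/-- `x` solves `ẋ = F(x)` on the time set `J` (derivatives are one-sided at end points of `J`). -/
def IsSolutionOn {X : Type*} [NormedAddCommGroup X] [NormedSpace ℝ X]
    (F : X → X) (J : Set ℝ) (x : ℝ → X) : Prop :=
  ∀ t ∈ J, HasDerivWithinAt x (F (x t)) J t

/-- `xs` is an equilibrium of `ẋ = F(x)`, stable in the sense of Lyapunov: for each neighbourhood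
`U` of `xs`, the solutions from all initial states close enough to `xs` exist for all `t ≥ 0` and
stay in `U`. -/
def IsLyapunovStable {X : Type*} [NormedAddCommGroup X] [NormedSpace ℝ X]
    (F : X → X) (xs : X) : Prop :=
  F xs = 0 ∧
    ∀ U ∈ 𝓝 xs, ∃ W ∈ 𝓝 xs, ∀ x₀ ∈ W,
      (∃ x : ℝ → X, IsSolutionOn F (Ici 0) x ∧ x 0 = x₀) ∧
      ∀ x : ℝ → X, IsSolutionOn F (Ici 0) x → x 0 = x₀ → ∀ t, 0 ≤ t → x t ∈ U

/-- As `t` runs through `[0, ∞)`, the distance from `f t` to the interval `[a, b]` never increases,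
and it tends to zero. -/
def MonotonicallyApproaches (f : ℝ → ℝ) (a b : ℝ) : Prop :=
  AntitoneOn (fun t => Metric.infDist (f t) (Icc a b)) (Ici 0) ∧
    Tendsto (fun t => Metric.infDist (f t) (Icc a b)) atTop (𝓝 0)

/-- The data of a power network on an undirected graph `G` of buses and lines: an orientation of
the lines, line susceptances, inertia, damping and power injection of the buses. -/
structure PowerNetwork {ι : Type*} (G : SimpleGraph ι) where
  /-- positive end of a line -/
  pos : G.edgeSet → ι
  /-- negative end of a line -/
  neg : G.edgeSet → ι
  ends : ∀ e : G.edgeSet, s(pos e, neg e) = (e : Sym2 ι)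
  /-- susceptances -/
  b : G.edgeSet → ℝ
  b_pos : ∀ e, 0 < b e
  /-- inertia coefficients -/
  M : ι → ℝ
  M_pos : ∀ i, 0 < M i
  /-- damping coefficients -/
  E : ι → ℝ
  E_pos : ∀ i, 0 < E i
  /-- active power injections -/
  p : ι → ℝ

/-- States `x = (λ, ω)`: angle differences along the lines and frequencies at the buses. -/
abbrev GridState {ι : Type*} (G : SimpleGraph ι) : Type _ := (G.edgeSet → ℝ) × (ι → ℝ)

/-- The controlled buses `C`, their safe frequency bounds `lo i < hi i`, the thresholds
`lo i < loTh i < hiTh i < hi i`, and the Lipschitz class-`𝒦` functions of the controller.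
Values at buses outside `C` are irrelevant. -/
structure FrequencySpec (ι : Type*) where
  C : Finset ι
  lo : ι → ℝ
  hi : ι → ℝ
  loTh : ι → ℝ
  hiTh : ι → ℝ
  lo_lt_loTh : ∀ i ∈ C, lo i < loTh i
  loTh_lt_hiTh : ∀ i ∈ C, loTh i < hiTh i
  hiTh_lt_hi : ∀ i ∈ C, hiTh i < hi i
  αhi : ι → ℝ → ℝ
  αlo : ι → ℝ → ℝ
  classK_αhi : ∀ i ∈ C, IsClassK (αhi i)
  classK_αlo : ∀ i ∈ C, IsClassK (αlo i)
  lipschitz_αhi : ∀ i ∈ C, LocallyLipschitz (αhi i)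
  lipschitz_αlo : ∀ i ∈ C, LocallyLipschitz (αlo i)

namespace PowerNetwork

variable {ι : Type*} [Fintype ι] [DecidableEq ι] {G : SimpleGraph ι} [DecidableRel G.Adj]

/-- The incidence matrix `D`. -/
def D (N : PowerNetwork G) : Matrix G.edgeSet ι ℝ :=
  Matrix.of fun e i => if i = N.pos e then 1 else if i = N.neg e then -1 else 0

/-- The diagonal matrix `Y_b` of susceptances. -/
def Yb (N : PowerNetwork G) : Matrix G.edgeSet G.edgeSet ℝ := Matrix.diagonal N.b

/-- The power flow vector `Dᵀ Y_b sin λ`. -/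
def flow (N : PowerNetwork G) (lam : G.edgeSet → ℝ) : ι → ℝ :=
  (N.D.transpose * N.Yb).mulVec fun e => Real.sin (lam e)

/-- The synchronous frequency `ω^∞ = (∑ p_i) / (∑ E_i)`. -/
def ωInf (N : PowerNetwork G) : ℝ := (∑ i, N.p i) / ∑ i, N.E i

/-- `p̃ = p - ω^∞ E 1`. -/
def pTilde (N : PowerNetwork G) : ι → ℝ := fun i => N.p i - N.ωInf * N.E i

/-- The column space of `D`. -/
def rangeD (N : PowerNetwork G) : Set (G.edgeSet → ℝ) := Set.range fun θ : ι → ℝ => N.D.mulVec θ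

/-- `Γ`: all angle differences are smaller than `π / 2` in absolute value. -/
def Γ (_N : PowerNetwork G) : Set (G.edgeSet → ℝ) := {lam | ∀ e, |lam e| < Real.pi / 2}

/-- `Γ_cl`: all angle differences are at most `π / 2` in absolute value. -/
def Γcl (_N : PowerNetwork G) : Set (G.edgeSet → ℝ) := {lam | ∀ e, |lam e| ≤ Real.pi / 2}

/-- `lamInf` is an equilibrium vector of angle differences: it lies in `Γ` and in the range of `D`,
and `p̃ = Dᵀ Y_b sin λ^∞`. -/
structure IsEquilibriumAngle (N : PowerNetwork G) (lamInf : G.edgeSet → ℝ) : Prop where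
  mem_Γ : lamInf ∈ N.Γ
  mem_rangeD : lamInf ∈ N.rangeD
  balance : N.pTilde = N.flow lamInf

/-- The equilibrium `(λ^∞, ω^∞ 1)`. -/
def equilibrium (N : PowerNetwork G) (lamInf : G.edgeSet → ℝ) : GridState G :=
  (lamInf, fun _ => N.ωInf)

/-- The energy function. -/
def energy (N : PowerNetwork G) (lamInf : G.edgeSet → ℝ) (x : GridState G) : ℝ :=
  1 / 2 * ∑ i, N.M i * (x.2 i - N.ωInf) ^ 2 +
    ∑ e, N.Yb e e * (Real.cos (lamInf e) - Real.cos (x.1 e) - x.1 e * Real.sin (lamInf e)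
      + lamInf e * Real.sin (lamInf e))

/-- `c`, the minimum over `∂Γ_cl` of the energy at frequency `ω^∞ 1`. -/
def cMin (N : PowerNetwork G) (lamInf : G.edgeSet → ℝ) : ℝ :=
  sInf ((fun lam => N.energy lamInf (lam, fun _ => N.ωInf)) '' frontier N.Γcl)

/-- The region `Φ` with parameter `β`. -/
def Φ (N : PowerNetwork G) (lamInf : G.edgeSet → ℝ) (β : ℝ) : Set (GridState G) :=
  {x | x.1 ∈ N.Γcl ∧ N.energy lamInf x ≤ N.cMin lamInf / β}

/-- `q_i(x, p) = E_i ω_i + [Dᵀ Y_b]_i sin λ - p_i`. -/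
def q (N : PowerNetwork G) (i : ι) (x : GridState G) : ℝ :=
  N.E i * x.2 i + N.flow x.1 i - N.p i

/-- The distributed controller `u_i(x, p)` of a bus `i`. -/
def control (N : PowerNetwork G) (S : FrequencySpec ι) (i : ι) (x : GridState G) : ℝ :=
  if S.hiTh i < x.2 i then
    min 0 (-S.αhi i (x.2 i - S.hi i) / (x.2 i - S.hiTh i) + N.q i x)
  else if x.2 i < S.loTh i then
    max 0 (S.αlo i (S.lo i - x.2 i) / (S.loTh i - x.2 i) + N.q i x)
  else 0

/-- The closed-loop vector field: `λ̇ = D ω` and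
`M_i ω̇_i = -E_i ω_i - [Dᵀ Y_b]_i sin λ + u_i + p_i`, with `u_i` present only at the buses of `C`. -/
def closedLoop (N : PowerNetwork G) (S : FrequencySpec ι) (x : GridState G) : GridState G :=
  (N.D.mulVec x.2, fun i =>
    (-N.E i * x.2 i - N.flow x.1 i + (if i ∈ S.C then N.control S i x else 0) + N.p i) / N.M i)

end PowerNetwork

end

/-! ### Ordinary differential equations and scalar comparison arguments. -/

section ODE

open scoped NNReal

variable {X : Type*} [NormedAddCommGroup X] [NormedSpace ℝ X] {F : X → X}

/-! Along solutions the energy satisfies V̇ ≤ -∑ E_i (ω_i - ω^∞)². The flow terms cancel by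
summation by parts, and the control does no positive work, since ω^∞ lies strictly between the
thresholds (`energyRate_le`). Over Γ_cl the energy is positive except at the equilibrium, and over
∂Γ_cl it is at least c > 0. A solution that starts in Φ_β with β > 1 therefore cannot cross ∂Γ_cl,
and Φ_β is compact; this yields invariance and global existence. The same barrier argument on a
small ball yields stability.

The closed loop is locally Lipschitz although u_i has a denominator that vanishes at the threshold:
there the quotient tends to +∞ and the minimum with 0 removes it (`locallyLipschitz_upperControl`).
Uniqueness follows.

Convergence comes from a Barbalat argument in place of LaSalle's principle. Since V converges, ω →
ω^∞; since ω̇ is Lipschitz in time, ω̇ → 0. Hence every cluster point has the same power flow as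
λ^∞, and the flow is injective on Γ_cl ∩ range D (`eq_of_flow_eq`).

The frequency bounds need no energy. Above the upper threshold the term q_i in the controller
cancels the whole bus dynamics and leaves M_i ω̇_i ≤ -ᾱ_i(ω_i - ω̄_i) / (ω_i - ω̄_i^th), whatever
the other buses do; the lower bound is the same statement for -ω_i (`excess_of_deriv_le`). This is
why these claims hold for every global solution. -/

lemma IsSolutionOn.mono {J J' : Set ℝ} {x : ℝ → X} (h : IsSolutionOn F J x) (hJ : J' ⊆ J) :
    IsSolutionOn F J' x :=
  fun t ht => (h t (hJ ht)).mono hJ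

lemma IsSolutionOn.continuousOn {J : Set ℝ} {x : ℝ → X} (h : IsSolutionOn F J x) :
    ContinuousOn x J :=
  fun t ht => (h t ht).continuousWithinAt

lemma IsSolutionOn.congr_field {F' : X → X} {J : Set ℝ} {x : ℝ → X} (h : IsSolutionOn F J x)
    (hF : ∀ t ∈ J, F (x t) = F' (x t)) : IsSolutionOn F' J x :=
  fun t ht => hF t ht ▸ h t ht

lemma HasDerivWithinAt.Ici_of_Icc {x : ℝ → X} {x' : X} {a b t : ℝ}
    (h : HasDerivWithinAt x x' (Icc a b) t) (ht : t ∈ Ico a b) :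
    HasDerivWithinAt x x' (Ici t) t :=
  h.mono_of_mem_nhdsWithin
    (mem_of_superset (Icc_mem_nhdsGE ht.2) (Icc_subset_Icc_left ht.1))

/-- Solutions of a locally Lipschitz equation are determined by their initial values. -/
lemma IsSolutionOn.eqOn_Icc (hF : LocallyLipschitz F) {T : ℝ} {x y : ℝ → X}
    (hx : IsSolutionOn F (Icc 0 T) x) (hy : IsSolutionOn F (Icc 0 T) y) (h0 : x 0 = y 0) :
    EqOn x y (Icc 0 T) := by
  -- The uniqueness theorem needs a single Lipschitz constant; the compact union of the two
  -- trajectories provides it.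
  have hc : IsCompact (x '' Icc 0 T ∪ y '' Icc 0 T) :=
    (isCompact_Icc.image_of_continuousOn hx.continuousOn).union
      (isCompact_Icc.image_of_continuousOn hy.continuousOn)
  obtain ⟨K, hK⟩ := (hF.locallyLipschitzOn).exists_lipschitzOnWith_of_compact hc
  exact ODE_solution_unique_of_mem_Icc_right (v := fun _ => F)
    (s := fun _ => x '' Icc 0 T ∪ y '' Icc 0 T) (fun _ _ => hK)
    hx.continuousOn (fun t ht => (hx t (Ico_subset_Icc_self ht)).Ici_of_Icc ht)
    (fun t ht => Or.inl (mem_image_of_mem _ (Ico_subset_Icc_self ht)))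
    hy.continuousOn (fun t ht => (hy t (Ico_subset_Icc_self ht)).Ici_of_Icc ht)
    (fun t ht => Or.inr (mem_image_of_mem _ (Ico_subset_Icc_self ht))) h0

/-- A bounded Lipschitz vector field has solutions on `[0, ∞)`. -/
lemma exists_isSolutionOn_Ici_of_bounded [CompleteSpace X] {K L : ℝ≥0} (hF : LipschitzWith K F)
    (hL : ∀ x, ‖F x‖ ≤ L) (x₀ : X) : ∃ x : ℝ → X, IsSolutionOn F (Ici 0) x ∧ x 0 = x₀ := by
  have hex : ∀ n : ℕ, ∃ x : ℝ → X, x 0 = x₀ ∧ IsSolutionOn F (Icc 0 (n : ℝ)) x := by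
    intro n
    -- The bound `L` holds everywhere, so a ball of radius `L * n` serves for the whole of [0, n]
    -- and the time interval need not shrink.
    have hPL : IsPicardLindelof (fun _ => F) (tmin := 0) (tmax := (n : ℝ))
        ⟨0, le_rfl, n.cast_nonneg⟩ x₀ (L * n) 0 L K :=
      { lipschitzOnWith := fun _ _ => hF.lipschitzOnWith
        continuousOn := fun _ _ => continuousOn_const
        norm_le := fun _ _ x _ => hL x
        mul_max_le := by simp }
    obtain ⟨x, h0, hx⟩ := hPL.exists_eq_forall_mem_Icc_hasDerivWithinAt₀
    exact ⟨x, h0, hx⟩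
  choose y hy0 hy using hex
  have hagree : ∀ n m : ℕ, ∀ t : ℝ, 0 ≤ t → t ≤ n → t ≤ m → y n t = y m t := by
    intro n m t h0 hn hm
    exact IsSolutionOn.eqOn_Icc hF.locallyLipschitz
      ((hy n).mono (Icc_subset_Icc_right hn)) ((hy m).mono (Icc_subset_Icc_right hm))
      ((hy0 n).trans (hy0 m).symm) ⟨h0, le_rfl⟩
  have hglue : ∀ n : ℕ, ∀ t ∈ Icc (0 : ℝ) n, y ⌈t⌉₊ t = y n t :=
    fun n t ht => hagree _ _ t ht.1 (Nat.le_ceil t) ht.2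
  refine ⟨fun t => y ⌈t⌉₊ t, fun t ht => ?_, by simp [hy0]⟩
  obtain ⟨n, hn⟩ := exists_nat_gt t
  have htn : t ∈ Icc (0 : ℝ) n := ⟨ht, hn.le⟩
  have h := (hy n t htn).congr (fun s hs => hglue n s hs) (hglue n t htn)
  rw [← hglue n t htn] at h
  refine h.mono_of_mem_nhdsWithin ?_
  rw [← Ici_inter_Iic]
  exact inter_mem self_mem_nhdsWithin (mem_nhdsWithin_of_mem_nhds (Iic_mem_nhds hn))

/-- A field that is Lipschitz on a ball agrees on a smaller ball with a bounded Lipschitz field. -/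
lemma exists_bounded_lipschitz_eqOn [ProperSpace X] (hF : LocallyLipschitz F) (R : ℝ) :
    ∃ (F' : X → X) (K L : ℝ≥0), LipschitzWith K F' ∧ (∀ x, ‖F' x‖ ≤ L) ∧
      ∀ x, ‖x‖ ≤ R → F' x = F x := by
  have hc : IsCompact (Metric.closedBall (0 : X) (R + 1)) := isCompact_closedBall _ _
  obtain ⟨K, hK⟩ := (hF.locallyLipschitzOn).exists_lipschitzOnWith_of_compact hc
  obtain ⟨B, hB⟩ := hc.exists_bound_of_continuousOn hF.continuous.continuousOn
  -- A 1-Lipschitz cutoff, equal to 1 on the ball of radius `R` and to 0 outside the ball of radius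
  -- `R + 1`.
  set ψ : X → ℝ := fun x => max 0 (min 1 (R + 1 - ‖x‖)) with hψ
  have hψ0 : ∀ x, 0 ≤ ψ x := fun x => le_max_left _ _
  have hψ1 : ∀ x, ψ x ≤ 1 := fun x => max_le zero_le_one (min_le_left _ _)
  have hψout : ∀ x, R + 1 < ‖x‖ → ψ x = 0 := fun x hx =>
    max_eq_left ((min_le_right _ _).trans (by linarith))
  have hψL : ∀ x y, |ψ x - ψ y| ≤ ‖x - y‖ := by
    intro x y
    have h1 : |ψ x - ψ y| ≤ |min 1 (R + 1 - ‖x‖) - min 1 (R + 1 - ‖y‖)| := by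
      have := abs_max_sub_max_le_max 0 (min 1 (R + 1 - ‖x‖)) 0 (min 1 (R + 1 - ‖y‖))
      simpa using this
    have h2 : |min 1 (R + 1 - ‖x‖) - min 1 (R + 1 - ‖y‖)| ≤ |(R + 1 - ‖x‖) - (R + 1 - ‖y‖)| := by
      have := abs_min_sub_min_le_max 1 (R + 1 - ‖x‖) 1 (R + 1 - ‖y‖)
      simpa using this
    have h3 : |(R + 1 - ‖x‖) - (R + 1 - ‖y‖)| = |‖x‖ - ‖y‖| := by
      rw [← abs_neg]; congr 1; ring
    exact h1.trans (h2.trans (h3.le.trans (abs_norm_sub_norm_le x y)))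
  set B' : ℝ≥0 := ⟨max B 0, le_max_right _ _⟩ with hB'
  have hB'b : ∀ x, ‖x‖ ≤ R + 1 → ‖F x‖ ≤ B' := fun x hx =>
    (hB x (by simpa using hx)).trans (le_max_left _ _)
  -- the asymmetric estimate, with `x` in the support
  have hone : ∀ x y, ‖x‖ ≤ R + 1 → ‖ψ x • F x - ψ y • F y‖ ≤ (B' + K : ℝ≥0) * ‖x - y‖ := by
    intro x y hx
    rw [NNReal.coe_add, add_mul]
    by_cases hy : ‖y‖ ≤ R + 1
    · have e : ψ x • F x - ψ y • F y = (ψ x - ψ y) • F x + ψ y • (F x - F y) := by module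
      rw [e]
      refine (norm_add_le _ _).trans (add_le_add ?_ ?_)
      · rw [norm_smul, Real.norm_eq_abs, mul_comm]
        exact mul_le_mul (hB'b x hx) (hψL x y) (abs_nonneg _) B'.2
      · rw [norm_smul, Real.norm_eq_abs, abs_of_nonneg (hψ0 y)]
        have := hK.norm_sub_le (by simpa using hx : x ∈ Metric.closedBall 0 (R + 1))
          (by simpa using hy : y ∈ Metric.closedBall 0 (R + 1))
        exact (mul_le_of_le_one_left (norm_nonneg _) (hψ1 y)).trans this
    · have hy0 := hψout y (not_le.1 hy)
      have e : ψ x • F x - ψ y • F y = (ψ x - ψ y) • F x := by rw [hy0]; module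
      rw [e, norm_smul, Real.norm_eq_abs, mul_comm]
      exact (mul_le_mul (hB'b x hx) (hψL x y) (abs_nonneg _) B'.2).trans
        (le_add_of_nonneg_right (by positivity))
  refine ⟨fun x => ψ x • F x, B' + K, B', LipschitzWith.of_dist_le_mul fun x y => ?_,
    fun x => ?_, fun x hx => ?_⟩
  · rw [dist_eq_norm, dist_eq_norm]
    by_cases hx : ‖x‖ ≤ R + 1
    · exact hone x y hx
    by_cases hy : ‖y‖ ≤ R + 1
    · rw [norm_sub_rev, norm_sub_rev x]
      exact hone y x hy
    · rw [hψout x (not_le.1 hx), hψout y (not_le.1 hy)]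
      simp only [zero_smul, sub_zero, norm_zero]
      positivity
  · by_cases hx : ‖x‖ ≤ R + 1
    · rw [norm_smul, Real.norm_eq_abs, abs_of_nonneg (hψ0 x)]
      exact (mul_le_of_le_one_left (norm_nonneg _) (hψ1 x)).trans (hB'b x hx)
    · simp [hψout x (not_le.1 hx)]
  · have : ψ x = 1 := by
      simp only [hψ]
      rw [min_eq_left (by linarith)]
      simp
    simp [this]

/-- If every solution on a compact time interval that starts at `x₀` stays in a fixed compact set,
then a solution on `[0, ∞)` exists. -/
lemma exists_isSolutionOn_Ici_of_trapped [ProperSpace X] (hF : LocallyLipschitz F) {K : Set X}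
    (hK : IsCompact K) {x₀ : X} (hx₀ : x₀ ∈ K)
    (htrap : ∀ T : ℝ, 0 ≤ T → ∀ x : ℝ → X, IsSolutionOn F (Icc 0 T) x → x 0 = x₀ → x T ∈ K) :
    ∃ x : ℝ → X, IsSolutionOn F (Ici 0) x ∧ x 0 = x₀ := by
  obtain ⟨R, hR⟩ := hK.isBounded.exists_norm_le
  -- The margin 1 makes the argument strict: until its norm first reaches `R + 1`, the solution for
  -- `F'` also solves the original equation, and at that instant the trap forces the norm to be at
  -- most `R`.
  obtain ⟨F', C, L, hF', hL, hFF'⟩ := exists_bounded_lipschitz_eqOn hF (R + 1)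
  obtain ⟨x, hx, hx0⟩ := exists_isSolutionOn_Ici_of_bounded hF' hL x₀
  have hcont : ContinuousOn (fun t => ‖x t‖) (Ici 0) := hx.continuousOn.norm
  have hstart : ‖x 0‖ ≤ R := hx0 ▸ hR _ hx₀
  have hbd : ∀ t, 0 ≤ t → ‖x t‖ ≤ R + 1 := by
    by_contra! h
    obtain ⟨t, ht, htR⟩ := h
    have hivt : ∀ s, 0 ≤ s → R + 1 < ‖x s‖ → ∃ r ∈ Icc 0 s, ‖x r‖ = R + 1 := fun s hs hsR =>
      intermediate_value_Icc hs (hcont.mono Icc_subset_Ici_self)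
        (show R + 1 ∈ Icc ‖x 0‖ ‖x s‖ from ⟨by linarith, hsR.le⟩)
    have hcl : IsCompact (Icc 0 t ∩ (fun s => ‖x s‖) ⁻¹' {R + 1}) :=
      isCompact_Icc.of_isClosed_subset
        ((hcont.mono Icc_subset_Ici_self).preimage_isClosed_of_isClosed isClosed_Icc
          isClosed_singleton) inter_subset_left
    obtain ⟨r, hr, hrR⟩ := hivt t ht htR
    obtain ⟨t₁, ⟨ht₁, ht₁R⟩, hmin⟩ := hcl.exists_isLeast ⟨r, hr, hrR⟩
    have ht₁R' : ‖x t₁‖ = R + 1 := ht₁R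
    have hbefore : ∀ s ∈ Icc 0 t₁, ‖x s‖ ≤ R + 1 := by
      intro s hs
      by_contra! hsR
      obtain ⟨r, hr, hrR⟩ := hivt s hs.1 hsR
      have : t₁ ≤ r := hmin ⟨⟨hr.1, hr.2.trans (hs.2.trans ht₁.2)⟩, hrR⟩
      have : s = t₁ := le_antisymm hs.2 (this.trans hr.2)
      rw [this, ht₁R'] at hsR
      exact lt_irrefl _ hsR
    have := hR _ (htrap t₁ ht₁.1 x ((hx.mono Icc_subset_Ici_self).congr_field
      fun s hs => hFF' _ (hbefore s hs)) hx0)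
    linarith
  exact ⟨x, hx.congr_field fun t ht => hFF' _ (hbd t ht), hx0⟩

/-- A curve along which `V` does not increase cannot leave a set on whose frontier `V` is larger
than at the initial point. -/
lemma mem_of_antitoneOn_of_frontier {Y : Type*} [TopologicalSpace Y] {x : ℝ → Y} {V : Y → ℝ}
    {S : Set Y} {T c : ℝ} (hT : 0 ≤ T) (hx : ContinuousOn x (Icc 0 T))
    (hV : AntitoneOn (fun t => V (x t)) (Icc 0 T)) (hfr : ∀ y ∈ frontier S, c ≤ V y)
    (h0 : x 0 ∈ S) (hV0 : V (x 0) < c) : x T ∈ S := by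
  by_contra hxT
  have hpre : IsPreconnected (x '' Icc 0 T) := isPreconnected_Icc.image x hx
  have hl : (0 : ℝ) ∈ Icc 0 T := ⟨le_rfl, hT⟩
  have hr : T ∈ Icc 0 T := ⟨hT, le_rfl⟩
  obtain ⟨_, ⟨t, ht, rfl⟩, hfrt⟩ : (x '' Icc 0 T ∩ frontier S).Nonempty := by
    by_contra hemp
    have hni : ∀ t ∈ Icc 0 T, x t ∉ frontier S := fun t ht hfrt =>
      hemp ⟨x t, mem_image_of_mem _ ht, hfrt⟩
    obtain ⟨y, -, hy1, hy2⟩ := hpre (interior S) (closure S)ᶜ isOpen_interior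
      isClosed_closure.isOpen_compl (by
        rintro _ ⟨t, ht, rfl⟩
        by_cases h : x t ∈ closure S
        · exact Or.inl (by_contra fun h' => hni t ht ⟨h, h'⟩)
        · exact Or.inr h)
      ⟨x 0, mem_image_of_mem _ hl, by_contra fun h' => hni 0 hl ⟨subset_closure h0, h'⟩⟩
      ⟨x T, mem_image_of_mem _ hr, fun h' =>
        hni T hr ⟨h', fun h'' => hxT (interior_subset h'')⟩⟩
    exact hy2 (subset_closure (interior_subset hy1))
  have h1 := hfr _ hfrt
  have h2 : V (x t) ≤ V (x 0) := hV hl ht ht.1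
  linarith

/-- If `g` converges and its derivative is at most `-f` with `f` Lipschitz, then `f` is eventually
smaller than any positive number. -/
lemma eventually_lt_of_hasDerivWithinAt_of_tendsto {g g' f : ℝ → ℝ} {K : ℝ≥0} {l : ℝ}
    (hg : ∀ t ∈ Ici (0 : ℝ), HasDerivWithinAt g (g' t) (Ici 0) t) (hl : Tendsto g atTop (𝓝 l))
    (hf : LipschitzOnWith K f (Ici 0)) (hgf : ∀ t ∈ Ici (0 : ℝ), g' t ≤ -f t) {ε : ℝ}
    (hε : 0 < ε) : ∀ᶠ t in atTop, f t < ε := by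
  -- On a window of length `δ` the function `f` changes by at most `ε / 2`.
  set δ : ℝ := ε / (2 * (K + 1)) with hδ
  have hK : (0 : ℝ) ≤ K := K.2
  have hδ0 : 0 < δ := by positivity
  have hKδ : K * δ ≤ ε / 2 := by
    rw [hδ, mul_div_assoc', div_le_div_iff₀ (by positivity) two_pos]
    nlinarith
  have h1 : Tendsto (fun t => g t - g (t + δ)) atTop (𝓝 0) := by
    simpa using hl.sub (hl.comp (tendsto_atTop_add_const_right _ δ tendsto_id))
  filter_upwards [h1.eventually (gt_mem_nhds (show 0 < δ * (ε / 2) by positivity)),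
    eventually_ge_atTop 0] with t ht ht0
  have hsub : Icc t (t + δ) ⊆ Ici 0 := fun s hs => ht0.trans hs.1
  -- Throughout the window `g` falls at rate at least `f t - ε / 2`, while its total drop there
  -- tends to zero.
  have hanti : AntitoneOn (fun s => g s + (f t - ε / 2) * s) (Icc t (t + δ)) := by
    have hd : ∀ s ∈ Icc t (t + δ), HasDerivWithinAt (fun s => g s + (f t - ε / 2) * s)
        (g' s + (f t - ε / 2) * 1) (Icc t (t + δ)) s := fun s hs =>
      ((hg s (hsub hs)).mono hsub).add ((hasDerivWithinAt_id s _).const_mul _)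
    refine antitoneOn_of_hasDerivWithinAt_nonpos (convex_Icc _ _)
      (fun s hs => (hd s hs).continuousWithinAt)
      (fun s hs => (hd s (interior_subset hs)).mono interior_subset) fun s hs => ?_
    have hs' := interior_subset hs
    have h2 := hf.dist_le_mul t ht0 s (hsub hs')
    rw [Real.dist_eq, Real.dist_eq] at h2
    have h3 : |t - s| ≤ δ := by
      rw [abs_sub_comm, abs_of_nonneg (by linarith [hs'.1])]
      linarith [hs'.2]
    have h4 : (K : ℝ) * |t - s| ≤ K * δ := mul_le_mul_of_nonneg_left h3 hK
    linarith [hgf s (hsub hs'), le_abs_self (f t - f s)]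
  have h5 := hanti (left_mem_Icc.2 (by linarith)) (right_mem_Icc.2 (by linarith))
    (show t ≤ t + δ by linarith)
  simp only at h5
  have h6 : δ * (f t - ε / 2) < δ * (ε / 2) := by nlinarith
  have := lt_of_mul_lt_mul_left h6 hδ0.le
  linarith

/-- A Barbalat-type lemma: if `g` converges and has a Lipschitz derivative, the derivative tends
to zero. -/
lemma tendsto_deriv_zero_of_tendsto {g g' : ℝ → ℝ} {K : ℝ≥0} {l : ℝ}
    (hg : ∀ t ∈ Ici (0 : ℝ), HasDerivWithinAt g (g' t) (Ici 0) t) (hl : Tendsto g atTop (𝓝 l))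
    (hg' : LipschitzOnWith K g' (Ici 0)) : Tendsto g' atTop (𝓝 0) := by
  rw [Metric.tendsto_nhds]
  intro ε hε
  filter_upwards [eventually_lt_of_hasDerivWithinAt_of_tendsto hg hl hg'.neg
      (fun t _ => by simp) hε,
    eventually_lt_of_hasDerivWithinAt_of_tendsto (fun t ht => (hg t ht).neg) hl.neg hg'
      (fun t _ => le_rfl) hε] with t h1 h2
  simp only [Pi.neg_apply] at h1
  rw [Real.dist_eq, sub_zero, abs_lt]
  exact ⟨by linarith, h2⟩

/-- If `f` strictly decreases whenever it exceeds `h`, then its excess over `h` never increases. -/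
lemma antitoneOn_max_sub_zero {f f' : ℝ → ℝ} {h : ℝ}
    (hf : ∀ t ∈ Ici (0 : ℝ), HasDerivWithinAt f (f' t) (Ici 0) t)
    (hneg : ∀ t ∈ Ici (0 : ℝ), h < f t → f' t < 0) :
    AntitoneOn (fun t => max (f t - h) 0) (Ici 0) := by
  intro s hs t ht hst
  have hsub : Icc s t ⊆ Ici 0 := fun r hr => le_trans hs hr.1
  -- A level `c` strictly above `h` gives the strict inequality at contact that the comparison
  -- theorem requires; afterwards `c` decreases to `max (f s) h`.
  have key : ∀ c, h < c → f s ≤ c → f t ≤ c := by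
    intro c hc hsc
    refine image_le_of_deriv_right_lt_deriv_boundary (f := f) (f' := f') (B := fun _ => c)
      (B' := fun _ => 0) (fun r hr => ((hf r (hsub hr)).mono hsub).continuousWithinAt)
      (fun r hr => (hf r (hsub (Ico_subset_Icc_self hr))).mono
        (Ici_subset_Ici.2 (hsub (Ico_subset_Icc_self hr)))) hsc
      (fun r => hasDerivAt_const r c) (fun r hr hrc => ?_) ⟨hst, le_rfl⟩
    exact hneg r (hsub (Ico_subset_Icc_self hr)) (by rw [hrc]; exact hc)
  have : f t ≤ max (f s) h := by
    refine le_of_forall_gt_imp_ge_of_dense fun c hc => key c ?_ ?_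
    · exact (le_max_right _ _).trans_lt hc
    · exact (le_max_left _ _).trans hc.le
  refine max_le ?_ (le_max_right _ _)
  rcases le_total (f s) h with h1 | h1
  · rw [max_eq_right h1] at this
    exact le_max_of_le_right (by linarith)
  · rw [max_eq_left h1] at this
    exact le_max_of_le_left (by linarith)

/-- If moreover `f` decreases at a uniform speed while it exceeds `h` by a fixed amount, then its
excess over `h` tends to zero. -/
lemma tendsto_max_sub_zero {f f' : ℝ → ℝ} {h : ℝ}
    (hf : ∀ t ∈ Ici (0 : ℝ), HasDerivWithinAt f (f' t) (Ici 0) t)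
    (hneg : ∀ t ∈ Ici (0 : ℝ), h < f t → f' t < 0)
    (hspeed : ∀ ε > 0, ∃ k > 0, ∀ t ∈ Ici (0 : ℝ), h + ε ≤ f t → f t ≤ max (f 0) h → f' t ≤ -k) :
    Tendsto (fun t => max (f t - h) 0) atTop (𝓝 0) := by
  have hanti := antitoneOn_max_sub_zero hf hneg
  rw [Metric.tendsto_nhds]
  intro ε hε
  obtain ⟨k, hk, hkf⟩ := hspeed (ε / 2) (half_pos hε)
  -- Otherwise `f` would decrease at speed at least `k` forever and fall below `h`. One such time
  -- suffices, as the excess is monotone.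
  obtain ⟨t₁, ht₁, hft₁⟩ : ∃ t₁ ∈ Ici (0 : ℝ), f t₁ < h + ε / 2 := by
    by_contra! hcon
    have hle : ∀ t ∈ Ici (0 : ℝ), f t ≤ max (f 0) h := by
      intro t ht
      have := (le_max_left _ _).trans (hanti (mem_Ici.2 le_rfl) ht ht)
      simp only [le_max_iff] at this
      rcases this with h1 | h1
      · exact le_max_of_le_left (by linarith)
      · exact le_max_of_le_right (by linarith)
    have hd : ∀ s ∈ Ici (0 : ℝ), HasDerivWithinAt (fun s => f s + k * s) (f' s + k * 1) (Ici 0) s :=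
      fun s hs => (hf s hs).add ((hasDerivWithinAt_id s _).const_mul _)
    have hanti' : AntitoneOn (fun s => f s + k * s) (Ici 0) :=
      antitoneOn_of_hasDerivWithinAt_nonpos (convex_Ici _)
        (fun s hs => (hd s hs).continuousWithinAt)
        (fun s hs => (hd s (interior_subset hs)).mono interior_subset)
        (fun s hs => by
          have := hkf s (interior_subset hs) (hcon s (interior_subset hs))
            (hle s (interior_subset hs))
          linarith)
    obtain ⟨n, hn⟩ := exists_nat_gt ((f 0 - h) / k)
    have h1 := hanti' (mem_Ici.2 le_rfl) (mem_Ici.2 n.cast_nonneg) (n.cast_nonneg : (0 : ℝ) ≤ n)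
    simp only [mul_zero, add_zero] at h1
    have h2 := hcon n (mem_Ici.2 n.cast_nonneg)
    rw [div_lt_iff₀ hk] at hn
    nlinarith
  filter_upwards [eventually_ge_atTop t₁] with t ht
  have h1 : max (f t - h) 0 ≤ max (f t₁ - h) 0 := hanti ht₁ (le_trans ht₁ ht) ht
  have h2 : max (f t₁ - h) 0 < ε := max_lt (by linarith) hε
  rw [Real.dist_eq, sub_zero, abs_of_nonneg (le_max_right _ _)]
  exact h1.trans_lt h2

end ODE

/-! ### Local Lipschitz continuity of the controller and of the closed loop. -/

section LocallyLipschitz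

variable {X Y : Type*} [PseudoEMetricSpace X] [PseudoEMetricSpace Y]

lemma locallyLipschitz_of_eventuallyEq {f : X → Y}
    (h : ∀ x, ∃ g : X → Y, LocallyLipschitz g ∧ f =ᶠ[𝓝 x] g) : LocallyLipschitz f := by
  intro x
  obtain ⟨g, hg, hfg⟩ := h x
  obtain ⟨K, t, ht, hK⟩ := hg x
  refine ⟨K, t ∩ {y | f y = g y}, inter_mem ht hfg, fun y hy z hz => ?_⟩
  rw [hy.2, hz.2]
  exact hK hy.1 hz.1

lemma LocallyLipschitz.real_mul {f g : X → ℝ} (hf : LocallyLipschitz f)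
    (hg : LocallyLipschitz g) : LocallyLipschitz fun x => f x * g x :=
  (contDiff_mul (𝕜 := ℝ) (n := 1) (𝔸 := ℝ)).locallyLipschitz.comp (hf.prodMk hg)

lemma LocallyLipschitz.real_sum {κ : Type*} (s : Finset κ) {f : κ → X → ℝ}
    (hf : ∀ k ∈ s, LocallyLipschitz (f k)) : LocallyLipschitz fun x => ∑ k ∈ s, f k x := by
  classical
  induction s using Finset.induction_on with
  | empty => simpa using LocallyLipschitz.const (0 : ℝ)
  | insert a s ha ih =>
    simp only [Finset.sum_insert ha]
    exact (hf a (Finset.mem_insert_self _ _)).add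
      (ih fun k hk => hf k (Finset.mem_insert_of_mem hk))

lemma locallyLipschitz_pi {κ : Type*} [Fintype κ] {Z : κ → Type*} [∀ k, PseudoEMetricSpace (Z k)]
    {f : X → ∀ k, Z k} (hf : ∀ k, LocallyLipschitz fun x => f x k) : LocallyLipschitz f := by
  intro x
  choose K t ht hK using fun k => hf k x
  refine ⟨∑ k, K k, ⋂ k, t k, iInter_mem.2 ht, fun y hy z hz => ?_⟩
  refine edist_pi_le_iff.2 fun k => ?_
  refine (hK k (mem_iInter.1 hy k) (mem_iInter.1 hz k)).trans ?_
  gcongr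
  exact Finset.single_le_sum (f := K) (fun _ _ => zero_le) (Finset.mem_univ k)

end LocallyLipschitz

lemma locallyLipschitz_inv_max {δ : ℝ} (hδ : 0 < δ) :
    LocallyLipschitz fun z : ℝ => (max δ z)⁻¹ := by
  refine (LipschitzWith.of_dist_le_mul (K := ⟨(δ ^ 2)⁻¹, by positivity⟩)
    fun x y => ?_).locallyLipschitz
  have hx : δ ≤ max δ x := le_max_left _ _
  have hy : δ ≤ max δ y := le_max_left _ _
  have hx0 := hδ.trans_le hx
  have hy0 := hδ.trans_le hy
  rw [Real.dist_eq, Real.dist_eq, inv_sub_inv hx0.ne' hy0.ne', abs_div,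
    abs_of_pos (mul_pos hx0 hy0), div_eq_inv_mul]
  have h1 : |max δ y - max δ x| ≤ |x - y| := by
    have := abs_max_sub_max_le_max δ y δ x
    rw [abs_sub_comm x y]
    simpa using this
  have h2 : (max δ x * max δ y)⁻¹ ≤ (δ ^ 2)⁻¹ := by
    rw [sq]; gcongr
  exact mul_le_mul h2 h1 (abs_nonneg _) (inv_nonneg.2 (sq_nonneg δ))

/-- The controller that acts above the upper threshold, as a function of frequency and
power mismatch. -/
noncomputable def upperControl (h hth : ℝ) (α : ℝ → ℝ) (z : ℝ × ℝ) : ℝ :=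
  if hth < z.1 then min 0 (-α (z.1 - h) / (z.1 - hth) + z.2) else 0

lemma locallyLipschitz_upperControl {h hth : ℝ} {α : ℝ → ℝ} (hh : hth < h) (hα : IsClassK α)
    (hL : LocallyLipschitz α) : LocallyLipschitz (upperControl h hth α) := by
  have hfst : LocallyLipschitz (Prod.fst : ℝ × ℝ → ℝ) := LipschitzWith.prod_fst.locallyLipschitz
  have hsnd : LocallyLipschitz (Prod.snd : ℝ × ℝ → ℝ) := LipschitzWith.prod_snd.locallyLipschitz
  refine locallyLipschitz_of_eventuallyEq fun z => ?_
  rcases lt_or_ge hth z.1 with hz | hz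
  -- Clipping the denominator at half its value at `z` changes nothing near `z` and removes the
  -- singularity.
  · set δ := (z.1 - hth) / 2 with hδ
    have hδ0 : 0 < δ := by rw [hδ]; linarith
    refine ⟨fun w => min 0 (-α (w.1 - h) * (max δ (w.1 - hth))⁻¹ + w.2), ?_, ?_⟩
    · have h1 : LocallyLipschitz fun w : ℝ × ℝ => -α (w.1 - h) :=
        (hL.comp (hfst.sub (LocallyLipschitz.const h))).neg
      have h2 : LocallyLipschitz fun w : ℝ × ℝ => (max δ (w.1 - hth))⁻¹ :=
        (locallyLipschitz_inv_max hδ0).comp (hfst.sub (LocallyLipschitz.const hth))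
      exact ((h1.real_mul h2).add hsnd).const_min 0
    · filter_upwards [continuous_fst.continuousAt.eventually
        (lt_mem_nhds (show hth + δ < z.1 by rw [hδ]; linarith))] with w hw
      have hw1 : δ ≤ w.1 - hth := by linarith
      rw [upperControl, if_pos (by linarith), max_eq_right hw1, div_eq_mul_inv]
  -- This case contains the singular point `z.1 = hth`. Since `hth < h`, the numerator stays above
  -- `k > 0` near `z`, so just above the threshold the quotient exceeds `|z.2| + 1`, which outweighs
  -- the second coordinate, and the minimum is 0.
  · refine ⟨fun _ => 0, LocallyLipschitz.const 0, ?_⟩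
    have hneg : α (z.1 - h) < 0 := hα.map_zero ▸ hα.strictMono (by linarith : z.1 - h < 0)
    set k := -α (z.1 - h) / 2 with hk
    have hk0 : 0 < k := by rw [hk]; linarith
    have hc : Continuous fun w : ℝ × ℝ => -α (w.1 - h) :=
      (hα.continuous.comp (continuous_fst.sub continuous_const)).neg
    have hm : 0 < |z.2| + 1 := by positivity
    filter_upwards [hc.continuousAt.eventually (lt_mem_nhds (show k < -α (z.1 - h) by linarith)),
      continuous_snd.continuousAt.eventually (lt_mem_nhds (show z.2 - 1 < z.2 by linarith)),
      continuous_fst.continuousAt.eventually (gt_mem_nhds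
        (show z.1 < hth + k / (|z.2| + 1) by have := div_pos hk0 hm; linarith))] with w h1 h2 h3
    unfold upperControl
    split_ifs with hw
    · have hw' : 0 < w.1 - hth := by linarith
      refine min_eq_left ?_
      have h4 : |z.2| + 1 ≤ -α (w.1 - h) / (w.1 - hth) := by
        rw [le_div_iff₀ hw']
        have h5 : w.1 - hth ≤ k / (|z.2| + 1) := by linarith
        rw [le_div_iff₀ hm] at h5
        linarith
      linarith [neg_abs_le z.2]
    · rfl

namespace PowerNetwork

variable {ι : Type*} [Fintype ι] [DecidableEq ι] {G : SimpleGraph ι} [DecidableRel G.Adj]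
  (N : PowerNetwork G) (S : FrequencySpec ι)

/-- The controller splits into a part that acts above and a part that acts below. -/
lemma control_eq {i : ι} (hi : i ∈ S.C) (x : GridState G) :
    N.control S i x = upperControl (S.hi i) (S.hiTh i) (S.αhi i) (x.2 i, N.q i x) -
      upperControl (-S.lo i) (-S.loTh i) (S.αlo i) (-x.2 i, -N.q i x) := by
  have hlt := S.loTh_lt_hiTh i hi
  unfold control upperControl
  rcases lt_or_ge (S.hiTh i) (x.2 i) with h | h
  · rw [if_pos h, if_pos h, if_neg (by simp only; linarith), sub_zero]
  · rw [if_neg (not_lt.2 h), if_neg (not_lt.2 h)]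
    rcases lt_or_ge (x.2 i) (S.loTh i) with h' | h'
    · rw [if_pos h', if_pos (by simp only; linarith), zero_sub, ← max_neg_neg, neg_zero]
      congr 1
      have e1 : -x.2 i - -S.lo i = S.lo i - x.2 i := by ring
      have e2 : -x.2 i - -S.loTh i = S.loTh i - x.2 i := by ring
      simp only [e1, e2]
      ring
    · rw [if_neg (not_lt.2 h'), if_neg (by simp only; linarith), sub_zero]

lemma flow_apply (lam : G.edgeSet → ℝ) (i : ι) :
    N.flow lam i = ∑ e, N.D e i * N.b e * Real.sin (lam e) := by
  simp [flow, Yb, Matrix.mulVec, dotProduct, Matrix.mul_diagonal]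

omit [DecidableEq ι] in
lemma locallyLipschitz_freq (i : ι) : LocallyLipschitz fun x : GridState G => x.2 i :=
  ((LipschitzWith.eval i).comp LipschitzWith.prod_snd).locallyLipschitz

lemma locallyLipschitz_flow (i : ι) :
    LocallyLipschitz fun x : GridState G => N.flow x.1 i := by
  simp only [flow_apply]
  refine LocallyLipschitz.real_sum _ fun e _ => (LocallyLipschitz.const _).real_mul ?_
  exact (Real.contDiff_sin.locallyLipschitz (𝕂 := ℝ)).comp
    ((LipschitzWith.eval e).comp LipschitzWith.prod_fst).locallyLipschitz

lemma locallyLipschitz_q (i : ι) : LocallyLipschitz (N.q i) :=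
  (((LocallyLipschitz.const _).real_mul (locallyLipschitz_freq i)).add
    (N.locallyLipschitz_flow i)).sub (LocallyLipschitz.const _)

lemma locallyLipschitz_control {i : ι} (hi : i ∈ S.C) : LocallyLipschitz (N.control S i) := by
  rw [show N.control S i = _ from funext (N.control_eq S hi)]
  have hq := N.locallyLipschitz_q i
  have hw := locallyLipschitz_freq (G := G) i
  refine LocallyLipschitz.sub ?_ ?_
  · exact (locallyLipschitz_upperControl (S.hiTh_lt_hi i hi) (S.classK_αhi i hi)
      (S.lipschitz_αhi i hi)).comp (hw.prodMk hq)
  · exact (locallyLipschitz_upperControl (neg_lt_neg (S.lo_lt_loTh i hi)) (S.classK_αlo i hi)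
      (S.lipschitz_αlo i hi)).comp (hw.neg.prodMk hq.neg)

lemma locallyLipschitz_closedLoop : LocallyLipschitz (N.closedLoop S) := by
  refine LocallyLipschitz.prodMk ?_ ?_
  · refine locallyLipschitz_pi fun e => ?_
    simp only [Matrix.mulVec, dotProduct]
    exact LocallyLipschitz.real_sum _ fun i _ =>
      (LocallyLipschitz.const _).real_mul (locallyLipschitz_freq i)
  · refine locallyLipschitz_pi fun i => ?_
    simp only [div_eq_mul_inv]
    refine LocallyLipschitz.real_mul (LocallyLipschitz.add (LocallyLipschitz.add
      (LocallyLipschitz.sub ?_ (N.locallyLipschitz_flow i)) ?_) (LocallyLipschitz.const _))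
      (LocallyLipschitz.const _)
    · exact (LocallyLipschitz.const _).real_mul (locallyLipschitz_freq i)
    · by_cases hi : i ∈ S.C
      · simp only [if_pos hi]
        exact N.locallyLipschitz_control S hi
      · simp only [if_neg hi]
        exact LocallyLipschitz.const 0

end PowerNetwork

/-! ### The energy function: dissipation, positivity and compact sublevel sets. -/

/-- The potential energy of a line with unit susceptance is positive off its equilibrium. -/
lemma line_energy_pos {a l : ℝ} (ha : |a| < Real.pi / 2) (hl : |l| ≤ Real.pi / 2) (hne : l ≠ a) :
    0 < Real.cos a - Real.cos l - l * Real.sin a + a * Real.sin a := by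
  -- By the mean value theorem the expression equals `(l - a) * (sin c - sin a)` for some `c`
  -- strictly between `a` and `l`; it is positive because sine increases on [-π/2, π/2].
  have hmvt : ∀ x y : ℝ, x < y → ∃ c ∈ Ioo x y, Real.cos y - Real.cos x = -Real.sin c * (y - x) := by
    intro x y hxy
    obtain ⟨c, hc, h⟩ := exists_deriv_eq_slope Real.cos hxy Real.continuous_cos.continuousOn
      Real.differentiable_cos.differentiableOn
    refine ⟨c, hc, ?_⟩
    rw [Real.deriv_cos, eq_div_iff (sub_ne_zero.2 hxy.ne')] at h
    exact h.symm
  rw [abs_lt] at ha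
  rw [abs_le] at hl
  have ha' : a ∈ Icc (-(Real.pi / 2)) (Real.pi / 2) := ⟨ha.1.le, ha.2.le⟩
  rcases lt_or_gt_of_ne hne with h | h
  · obtain ⟨c, hc, e⟩ := hmvt l a h
    have := Real.strictMonoOn_sin ⟨by linarith [hc.1], by linarith [hc.2]⟩ ha' hc.2
    nlinarith
  · obtain ⟨c, hc, e⟩ := hmvt a l h
    have := Real.strictMonoOn_sin ha' ⟨by linarith [hc.1], by linarith [hc.2]⟩ hc.1
    nlinarith

lemma line_energy_nonneg {a l : ℝ} (ha : |a| < Real.pi / 2) (hl : |l| ≤ Real.pi / 2) :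
    0 ≤ Real.cos a - Real.cos l - l * Real.sin a + a * Real.sin a := by
  rcases eq_or_ne l a with rfl | hne
  · simp
  · exact (line_energy_pos ha hl hne).le

namespace PowerNetwork

set_option linter.unusedSectionVars false

variable {ι : Type*} [Fintype ι] [DecidableEq ι] {G : SimpleGraph ι} [DecidableRel G.Adj]
  (N : PowerNetwork G) (S : FrequencySpec ι) {lamInf : G.edgeSet → ℝ}

lemma pos_ne_neg (e : G.edgeSet) : N.pos e ≠ N.neg e := by
  intro h
  have h1 := G.not_isDiag_of_mem_edgeSet e.2
  rw [← N.ends e, h] at h1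
  exact h1 (by simp)

lemma D_mulVec_const (c : ℝ) : N.D.mulVec (fun _ => c) = 0 := by
  ext e
  have h : ∀ i, N.D e i = (if i = N.pos e then 1 else 0) - (if i = N.neg e then 1 else 0) := by
    intro i
    have := N.pos_ne_neg e
    simp only [D, Matrix.of_apply]
    split_ifs with h1 h2 <;> simp_all
  simp [Matrix.mulVec, dotProduct, h, sub_mul, Finset.sum_sub_distrib]

/-- Summation by parts on the network. -/
lemma sum_b_mul_sin_mul_D_mulVec (lam : G.edgeSet → ℝ) (θ : ι → ℝ) :
    ∑ e, N.b e * Real.sin (lam e) * N.D.mulVec θ e = ∑ i, θ i * N.flow lam i := by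
  simp only [flow_apply, Matrix.mulVec, dotProduct, Finset.mul_sum]
  rw [Finset.sum_comm]
  refine Finset.sum_congr rfl fun i _ => Finset.sum_congr rfl fun e _ => ?_
  ring

lemma Yb_apply_same (e : G.edgeSet) : N.Yb e e = N.b e := by
  simp [Yb]

/-- The derivative of the energy along the closed loop. -/
noncomputable def energyRate (lamInf : G.edgeSet → ℝ) (x : GridState G) : ℝ :=
  ∑ i, N.M i * (x.2 i - N.ωInf) * (N.closedLoop S x).2 i +
    ∑ e, N.b e * (Real.sin (x.1 e) - Real.sin (lamInf e)) * (N.closedLoop S x).1 e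

variable {N S}

lemma hasDerivWithinAt_freq {J : Set ℝ} {x : ℝ → GridState G}
    (hx : IsSolutionOn (N.closedLoop S) J x) {t : ℝ} (ht : t ∈ J) (i : ι) :
    HasDerivWithinAt (fun t => (x t).2 i) ((N.closedLoop S (x t)).2 i) J t :=
  hasDerivWithinAt_pi.1 (hx t ht).snd i

lemma hasDerivWithinAt_angle {J : Set ℝ} {x : ℝ → GridState G}
    (hx : IsSolutionOn (N.closedLoop S) J x) {t : ℝ} (ht : t ∈ J) (e : G.edgeSet) :
    HasDerivWithinAt (fun t => (x t).1 e) ((N.closedLoop S (x t)).1 e) J t :=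
  hasDerivWithinAt_pi.1 (hx t ht).fst e

lemma hasDerivWithinAt_energy {J : Set ℝ} {x : ℝ → GridState G}
    (hx : IsSolutionOn (N.closedLoop S) J x) {t : ℝ} (ht : t ∈ J) :
    HasDerivWithinAt (fun t => N.energy lamInf (x t)) (N.energyRate S lamInf (x t)) J t := by
  unfold energy energyRate
  refine HasDerivWithinAt.add ?_ ?_
  · have h : HasDerivWithinAt (fun t => 1 / 2 * ∑ i, N.M i * ((x t).2 i - N.ωInf) ^ 2)
        (1 / 2 * ∑ i, N.M i * (((2 : ℕ) : ℝ) * ((x t).2 i - N.ωInf) ^ (2 - 1) *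
          (N.closedLoop S (x t)).2 i)) J t :=
      (HasDerivWithinAt.fun_sum fun i _ =>
        (((hasDerivWithinAt_freq hx ht i).sub_const N.ωInf).pow 2).const_mul (N.M i)).const_mul _
    refine h.congr_deriv ?_
    rw [Finset.mul_sum]
    refine Finset.sum_congr rfl fun i _ => ?_
    norm_num
    ring
  · refine HasDerivWithinAt.fun_sum fun e _ => ?_
    have hl := hasDerivWithinAt_angle hx ht e
    have h := ((((hl.cos.const_sub (Real.cos (lamInf e))).sub
      (hl.mul_const (Real.sin (lamInf e)))).add_const
        (lamInf e * Real.sin (lamInf e))).const_mul (N.Yb e e))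
    refine h.congr_deriv ?_
    rw [Yb_apply_same]
    ring

lemma M_mul_closedLoop (x : GridState G) (i : ι) :
    N.M i * (N.closedLoop S x).2 i =
      -N.E i * x.2 i - N.flow x.1 i + (if i ∈ S.C then N.control S i x else 0) + N.p i := by
  simp only [closedLoop]
  exact mul_div_cancel₀ _ (N.M_pos i).ne'

/-- The control pushes only downwards above the upper threshold and only upwards below the lower
one, hence always towards `w`. -/
lemma sub_mul_control_nonpos {i : ι} {w : ℝ} (hw : w ∈ Ioo (S.loTh i) (S.hiTh i))
    (x : GridState G) : (x.2 i - w) * N.control S i x ≤ 0 := by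
  unfold control
  split_ifs with h1 h2
  · exact mul_nonpos_of_nonneg_of_nonpos (by linarith [hw.2]) (min_le_left _ _)
  · exact mul_nonpos_of_nonpos_of_nonneg (by linarith [hw.1]) (le_max_left _ _)
  · simp

lemma energyRate_le (hlam : N.IsEquilibriumAngle lamInf)
    (hω : ∀ i ∈ S.C, N.ωInf ∈ Ioo (S.loTh i) (S.hiTh i)) (x : GridState G) :
    N.energyRate S lamInf x ≤ -∑ i, N.E i * (x.2 i - N.ωInf) ^ 2 := by
  -- Constants lie in the kernel of `D`, so the frequencies may be measured from ω^∞; the potential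
  -- part then cancels the flow terms of the kinetic part.
  have hD : N.D.mulVec x.2 = N.D.mulVec (fun i => x.2 i - N.ωInf) := by
    rw [show (fun i => x.2 i - N.ωInf) = x.2 - fun _ => N.ωInf from rfl, Matrix.mulVec_sub,
      D_mulVec_const, sub_zero]
  have h2 : ∑ e, N.b e * (Real.sin (x.1 e) - Real.sin (lamInf e)) * (N.closedLoop S x).1 e =
      ∑ i, (x.2 i - N.ωInf) * (N.flow x.1 i - N.pTilde i) := by
    simp only [closedLoop, hD, mul_sub, sub_mul, Finset.sum_sub_distrib, hlam.balance,
      sum_b_mul_sin_mul_D_mulVec]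
  rw [energyRate, h2, ← Finset.sum_add_distrib, ← Finset.sum_neg_distrib]
  refine Finset.sum_le_sum fun i _ => ?_
  have h3 := M_mul_closedLoop (N := N) (S := S) x i
  have e : N.M i * (x.2 i - N.ωInf) * (N.closedLoop S x).2 i =
      (x.2 i - N.ωInf) * (N.M i * (N.closedLoop S x).2 i) := by ring
  rw [e, h3, pTilde]
  have h4 : (x.2 i - N.ωInf) * (if i ∈ S.C then N.control S i x else 0) ≤ 0 := by
    split_ifs with hi
    · exact sub_mul_control_nonpos (hω i hi) x
    · simp
  linarith

lemma antitoneOn_energy (hlam : N.IsEquilibriumAngle lamInf)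
    (hω : ∀ i ∈ S.C, N.ωInf ∈ Ioo (S.loTh i) (S.hiTh i)) {J : Set ℝ} (hJ : Convex ℝ J)
    {x : ℝ → GridState G} (hx : IsSolutionOn (N.closedLoop S) J x) :
    AntitoneOn (fun t => N.energy lamInf (x t)) J := by
  refine antitoneOn_of_hasDerivWithinAt_nonpos hJ
    (fun t ht => (hasDerivWithinAt_energy hx ht).continuousWithinAt)
    (fun t ht => (hasDerivWithinAt_energy hx (interior_subset ht)).mono interior_subset)
    fun t _ => (energyRate_le hlam hω (x t)).trans ?_
  exact neg_nonpos.2 (Finset.sum_nonneg fun i _ => mul_nonneg (N.E_pos i).le (sq_nonneg _))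

variable (N)

lemma continuous_energy (lamInf : G.edgeSet → ℝ) : Continuous (N.energy lamInf) := by
  unfold energy
  fun_prop

lemma Γcl_eq_pi : N.Γcl = Set.univ.pi fun _ => Icc (-(Real.pi / 2)) (Real.pi / 2) := by
  ext lam
  simp only [Γcl, Set.mem_ofPred_eq, Set.mem_univ_pi, abs_le, mem_Icc]

lemma isCompact_Γcl : IsCompact N.Γcl := by
  rw [Γcl_eq_pi]
  exact isCompact_univ_pi fun _ => isCompact_Icc

lemma isOpen_Γ : IsOpen N.Γ := by
  simp only [Γ, ofPred_forall]
  exact isOpen_iInter_of_finite fun e =>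
    isOpen_lt (continuous_abs.comp (continuous_apply e)) continuous_const

lemma Γ_subset_Γcl : N.Γ ⊆ N.Γcl := fun _ h e => (h e).le

variable {N}

lemma kinetic_le_energy (hlam : N.IsEquilibriumAngle lamInf) {x : GridState G}
    (hx : x.1 ∈ N.Γcl) (i : ι) :
    1 / 2 * (N.M i * (x.2 i - N.ωInf) ^ 2) ≤ N.energy lamInf x := by
  have h1 : 0 ≤ ∑ e, N.Yb e e * (Real.cos (lamInf e) - Real.cos (x.1 e)
      - x.1 e * Real.sin (lamInf e) + lamInf e * Real.sin (lamInf e)) :=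
    Finset.sum_nonneg fun e _ => mul_nonneg (by rw [Yb_apply_same]; exact (N.b_pos e).le)
      (line_energy_nonneg (hlam.mem_Γ e) (hx e))
  have h2 := Finset.single_le_sum (f := fun i => N.M i * (x.2 i - N.ωInf) ^ 2)
    (fun j _ => mul_nonneg (N.M_pos j).le (sq_nonneg _)) (Finset.mem_univ i)
  unfold energy
  linarith

lemma energy_pos (hlam : N.IsEquilibriumAngle lamInf) {x : GridState G} (hx : x.1 ∈ N.Γcl)
    (hne : x ≠ N.equilibrium lamInf) : 0 < N.energy lamInf x := by
  have hk : ∀ i, 0 ≤ N.M i * (x.2 i - N.ωInf) ^ 2 := fun j =>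
    mul_nonneg (N.M_pos j).le (sq_nonneg _)
  have hp : ∀ e, 0 ≤ N.Yb e e * (Real.cos (lamInf e) - Real.cos (x.1 e)
      - x.1 e * Real.sin (lamInf e) + lamInf e * Real.sin (lamInf e)) := fun e =>
    mul_nonneg (by rw [Yb_apply_same]; exact (N.b_pos e).le)
      (line_energy_nonneg (hlam.mem_Γ e) (hx e))
  by_cases h1 : x.1 = lamInf
  · have h2 : x.2 ≠ fun _ => N.ωInf := fun h2 => hne (Prod.ext h1 h2)
    obtain ⟨i, hi⟩ := Function.ne_iff.1 h2
    refine add_pos_of_pos_of_nonneg (mul_pos one_half_pos ?_) (Finset.sum_nonneg fun e _ => hp e)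
    exact Finset.sum_pos' (fun i _ => hk i) ⟨i, Finset.mem_univ i,
      mul_pos (N.M_pos i) (sq_pos_of_ne_zero (sub_ne_zero.2 hi))⟩
  · obtain ⟨e, he⟩ := Function.ne_iff.1 h1
    refine add_pos_of_nonneg_of_pos (mul_nonneg one_half_pos.le (Finset.sum_nonneg fun i _ => hk i))
      (Finset.sum_pos' (fun e _ => hp e) ⟨e, Finset.mem_univ e, ?_⟩)
    exact mul_pos (by rw [Yb_apply_same]; exact N.b_pos e)
      (line_energy_pos (hlam.mem_Γ e) (hx e) he)

lemma energy_equilibrium (lamInf : G.edgeSet → ℝ) :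
    N.energy lamInf (N.equilibrium lamInf) = 0 := by
  simp [energy, equilibrium]

lemma energy_nonneg (hlam : N.IsEquilibriumAngle lamInf) {x : GridState G} (hx : x.1 ∈ N.Γcl) :
    0 ≤ N.energy lamInf x := by
  rcases eq_or_ne x (N.equilibrium lamInf) with rfl | hne
  · rw [energy_equilibrium]
  · exact (energy_pos hlam hx hne).le

lemma isClosed_sublevel (lamInf : G.edgeSet → ℝ) (C : ℝ) :
    IsClosed {x : GridState G | x.1 ∈ N.Γcl ∧ N.energy lamInf x ≤ C} :=
  (N.isCompact_Γcl.isClosed.preimage continuous_fst).inter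
    (isClosed_le (N.continuous_energy lamInf) continuous_const)

/-- The angles lie in a compact box, and since the potential part is nonnegative there, the energy
bounds every frequency deviation. -/
lemma isCompact_sublevel (hlam : N.IsEquilibriumAngle lamInf) (C : ℝ) :
    IsCompact {x : GridState G | x.1 ∈ N.Γcl ∧ N.energy lamInf x ≤ C} := by
  have hc : IsCompact (N.Γcl ×ˢ Set.univ.pi fun i =>
      Icc (N.ωInf - √(2 * C / N.M i)) (N.ωInf + √(2 * C / N.M i))) :=
    N.isCompact_Γcl.prod (isCompact_univ_pi fun _ => isCompact_Icc)
  refine hc.of_isClosed_subset (isClosed_sublevel lamInf C) ?_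
  rintro x ⟨hx1, hx2⟩
  refine ⟨hx1, fun i _ => ?_⟩
  have h1 := kinetic_le_energy hlam hx1 i
  have h2 : (x.2 i - N.ωInf) ^ 2 ≤ 2 * C / N.M i := by
    rw [le_div_iff₀ (N.M_pos i)]
    linarith
  have h3 := abs_le.1 (Real.abs_le_sqrt h2)
  exact ⟨by linarith, by linarith⟩

/-- Kinetic energy is nonnegative, so the minimum at ω = ω^∞ 1 bounds the energy at every ω.
Nonnegativity on Γ_cl makes the infimum a genuine lower bound. -/
lemma cMin_le_energy (hlam : N.IsEquilibriumAngle lamInf) {x : GridState G}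
    (hx : x.1 ∈ frontier N.Γcl) : N.cMin lamInf ≤ N.energy lamInf x := by
  have hcl : frontier N.Γcl ⊆ N.Γcl := N.isCompact_Γcl.isClosed.frontier_subset
  have h1 : N.cMin lamInf ≤ N.energy lamInf (x.1, fun _ => N.ωInf) := by
    refine csInf_le ⟨0, ?_⟩ (mem_image_of_mem _ hx)
    rintro _ ⟨lam, hl, rfl⟩
    exact energy_nonneg hlam (hcl hl)
  refine h1.trans ?_
  unfold energy
  have : 0 ≤ ∑ i, N.M i * (x.2 i - N.ωInf) ^ 2 :=
    Finset.sum_nonneg fun i _ => mul_nonneg (N.M_pos i).le (sq_nonneg _)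
  simp only [sub_self, ne_eq, OfNat.ofNat_ne_zero, not_false_eq_true, zero_pow, mul_zero,
    Finset.sum_const_zero, zero_add]
  linarith

/-- The minimum is attained on the compact frontier, which misses λ^∞ because Γ is an open subset of
Γ_cl. Without a line the frontier would be empty and `sInf ∅ = 0`. -/
lemma cMin_pos [Nonempty G.edgeSet] (hlam : N.IsEquilibriumAngle lamInf) :
    0 < N.cMin lamInf := by
  have hcl : frontier N.Γcl ⊆ N.Γcl := N.isCompact_Γcl.isClosed.frontier_subset
  have hc : IsCompact (frontier N.Γcl) := N.isCompact_Γcl.of_isClosed_subset isClosed_frontier hcl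
  have hne : (frontier N.Γcl).Nonempty := by
    refine nonempty_frontier_iff.2 ⟨⟨lamInf, N.Γ_subset_Γcl hlam.mem_Γ⟩, fun h => ?_⟩
    have h1 : (fun _ => Real.pi : G.edgeSet → ℝ) ∈ N.Γcl := h ▸ mem_univ _
    have h2 := h1 (Classical.arbitrary _)
    rw [abs_of_pos Real.pi_pos] at h2
    linarith [Real.pi_pos]
  have hcont : Continuous fun lam : G.edgeSet → ℝ => N.energy lamInf (lam, fun _ => N.ωInf) :=
    (N.continuous_energy lamInf).comp (by fun_prop)
  obtain ⟨lam, hl, he⟩ := (hc.image hcont).sInf_mem (hne.image _)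
  rw [cMin, ← he]
  refine energy_pos hlam (hcl hl) fun h => ?_
  have h1 : lam = lamInf := congrArg Prod.fst h
  rw [h1] at hl
  exact hl.2 (interior_maximal N.Γ_subset_Γcl N.isOpen_Γ hlam.mem_Γ)

end PowerNetwork

/-! ### Convergence and Lyapunov stability. -/

lemma AntitoneOn.tendsto_atTop_of_bddBelow {f : ℝ → ℝ} {B : ℝ} (hf : AntitoneOn f (Ici 0))
    (hB : ∀ t ∈ Ici (0 : ℝ), B ≤ f t) : ∃ l, Tendsto f atTop (𝓝 l) := by
  have h1 : Antitone fun t => f (max 0 t) := fun s t hst =>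
    hf (mem_Ici.2 (le_max_left _ _)) (mem_Ici.2 (le_max_left _ _)) (max_le_max_left _ hst)
  refine ⟨_, (tendsto_atTop_ciInf h1 ⟨B, ?_⟩).congr' ?_⟩
  · rintro _ ⟨t, rfl⟩
    exact hB _ (mem_Ici.2 (le_max_left _ _))
  · filter_upwards [eventually_ge_atTop 0] with t ht
    rw [max_eq_right ht]

lemma MapClusterPt.eq_of_tendsto {X Y Z : Type*} [TopologicalSpace Y] [TopologicalSpace Z]
    [T2Space Z] {l : Filter X} {f : X → Y} {y : Y} (h : MapClusterPt y l f) {φ : Y → Z}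
    (hφ : ContinuousAt φ y) {z : Z} (hz : Tendsto (φ ∘ f) l (𝓝 z)) : φ y = z := by
  have h1 : ClusterPt (φ y) (map (φ ∘ f) l) := h.continuousAt_comp hφ
  have h2 : ClusterPt (φ y) (𝓝 z) := h1.mono hz
  exact @eq_of_nhds_neBot _ _ _ _ _ h2

namespace PowerNetwork

set_option linter.unusedSectionVars false

variable {ι : Type*} [Fintype ι] [DecidableEq ι] {G : SimpleGraph ι} [DecidableRel G.Adj]
  {N : PowerNetwork G} {S : FrequencySpec ι} {lamInf : G.edgeSet → ℝ}

lemma rangeD_eq (N : PowerNetwork G) :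
    N.rangeD = (LinearMap.range (Matrix.mulVecLin N.D) : Set (G.edgeSet → ℝ)) := by
  ext lam
  simp [rangeD]

lemma isClosed_rangeD (N : PowerNetwork G) : IsClosed N.rangeD := by
  rw [rangeD_eq]
  exact Submodule.closed_of_finiteDimensional _

lemma mem_rangeD_of_isSolutionOn {T : ℝ} (hT : 0 ≤ T) {x : ℝ → GridState G}
    (hx : IsSolutionOn (N.closedLoop S) (Icc 0 T) x) (h0 : (x 0).1 ∈ N.rangeD) :
    (x T).1 ∈ N.rangeD := by
  rw [rangeD_eq] at h0 ⊢
  by_contra h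
  -- A linear functional that vanishes on range D is conserved, since λ̇ = D ω; it would separate
  -- the final angles from the subspace.
  obtain ⟨f, hf, hker⟩ := Submodule.exists_le_ker_of_notMem h
  have hd : ∀ t ∈ Icc 0 T, HasDerivWithinAt (fun t => f (x t).1) 0 (Icc 0 T) t := by
    intro t ht
    have h1 := f.toContinuousLinearMap.hasFDerivAt.comp_hasDerivWithinAt t (hx t ht).fst
    have h2 : f (N.closedLoop S (x t)).1 = 0 := hker ⟨(x t).2, rfl⟩
    exact h1.congr_deriv h2
  have h1 := constant_of_has_deriv_right_zero (fun t ht => (hd t ht).continuousWithinAt)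
    (fun t ht => (hd t (Ico_subset_Icc_self ht)).Ici_of_Icc ht) T ⟨hT, le_rfl⟩
  exact hf (h1.trans (hker h0))

/-- The power flow is injective on the angle differences in `Γ_cl ∩ range D`. -/
lemma eq_of_flow_eq {lam lam' : G.edgeSet → ℝ} (h1 : lam ∈ N.rangeD) (h1' : lam' ∈ N.rangeD)
    (h2 : lam ∈ N.Γcl) (h2' : lam' ∈ N.Γcl) (h : N.flow lam = N.flow lam') : lam = lam' := by
  obtain ⟨θ, rfl⟩ := h1
  obtain ⟨θ', rfl⟩ := h1'
  simp only at h h2 h2' ⊢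
  set l := N.D.mulVec θ with hl
  set l' := N.D.mulVec θ' with hl'
  -- Equal flows paired with `θ - θ'` give this sum; its terms are nonnegative by monotonicity of
  -- sine, so each vanishes.
  have hsum : ∑ e, N.b e * ((Real.sin (l e) - Real.sin (l' e)) * (l e - l' e)) = 0 := by
    have hd : ∀ e, l e - l' e = N.D.mulVec (θ - θ') e := by
      intro e; rw [Matrix.mulVec_sub]; rfl
    have e1 := N.sum_b_mul_sin_mul_D_mulVec l (θ - θ')
    have e2 := N.sum_b_mul_sin_mul_D_mulVec l' (θ - θ')
    rw [h] at e1
    rw [← sub_self (∑ i, (θ - θ') i * N.flow l' i)]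
    nth_rewrite 1 [← e1]
    rw [← e2, ← Finset.sum_sub_distrib]
    refine Finset.sum_congr rfl fun e _ => ?_
    rw [hd]; ring
  have hI : ∀ lam : G.edgeSet → ℝ, lam ∈ N.Γcl → ∀ e, lam e ∈ Icc (-(Real.pi / 2)) (Real.pi / 2) :=
    fun lam h e => abs_le.1 (h e)
  have hnn : ∀ e, 0 ≤ N.b e * ((Real.sin (l e) - Real.sin (l' e)) * (l e - l' e)) := by
    intro e
    refine mul_nonneg (N.b_pos e).le ?_
    rcases le_total (l e) (l' e) with hle | hle
    · have := Real.strictMonoOn_sin.monotoneOn (hI _ h2 e) (hI _ h2' e) hle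
      exact mul_nonneg_of_nonpos_of_nonpos (by linarith) (by linarith)
    · have := Real.strictMonoOn_sin.monotoneOn (hI _ h2' e) (hI _ h2 e) hle
      exact mul_nonneg (by linarith) (by linarith)
  funext e
  have h3 := (Finset.sum_eq_zero_iff_of_nonneg fun e _ => hnn e).1 hsum e (Finset.mem_univ e)
  rcases mul_eq_zero.1 ((mul_eq_zero.1 h3).resolve_left (N.b_pos e).ne') with h4 | h4
  · exact Real.strictMonoOn_sin.injOn (hI _ h2 e) (hI _ h2' e) (sub_eq_zero.1 h4)
  · exact sub_eq_zero.1 h4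

lemma control_eq_zero {i : ι} {x : GridState G} (h : x.2 i ∈ Ioo (S.loTh i) (S.hiTh i)) :
    N.control S i x = 0 := by
  rw [control, if_neg (not_lt.2 h.2.le), if_neg (not_lt.2 h.1.le)]

lemma closedLoop_equilibrium (hlam : N.IsEquilibriumAngle lamInf)
    (hω : ∀ i ∈ S.C, N.ωInf ∈ Ioo (S.loTh i) (S.hiTh i)) :
    N.closedLoop S (N.equilibrium lamInf) = 0 := by
  refine Prod.ext (N.D_mulVec_const _) (funext fun i => ?_)
  have h1 : (if i ∈ S.C then N.control S i (N.equilibrium lamInf) else 0) = 0 := by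
    split_ifs with hi
    exacts [control_eq_zero (hω i hi), rfl]
  have h2 := congrFun hlam.balance i
  have h3 := M_mul_closedLoop (N := N) (S := S) (N.equilibrium lamInf) i
  simp only [pTilde] at h2
  rw [h1, show N.flow (N.equilibrium lamInf).1 i = N.flow lamInf i from rfl, ← h2,
    show (N.equilibrium lamInf).2 i = N.ωInf from rfl] at h3
  exact (mul_eq_zero.1 (h3.trans (by ring))).resolve_left (N.M_pos i).ne'

/-- A bounded solution whose angle differences stay in `Γ_cl ∩ range D` converges. -/
lemma tendsto_equilibrium (hlam : N.IsEquilibriumAngle lamInf)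
    (hω : ∀ i ∈ S.C, N.ωInf ∈ Ioo (S.loTh i) (S.hiTh i)) {K : Set (GridState G)}
    (hK : IsCompact K) (hKΓ : ∀ y ∈ K, y.1 ∈ N.Γcl) (hKD : ∀ y ∈ K, y.1 ∈ N.rangeD)
    {x : ℝ → GridState G} (hx : IsSolutionOn (N.closedLoop S) (Ici 0) x)
    (hxK : ∀ t ∈ Ici (0 : ℝ), x t ∈ K) : Tendsto x atTop (𝓝 (N.equilibrium lamInf)) := by
  have hF := N.locallyLipschitz_closedLoop S
  obtain ⟨C, hC⟩ := hF.locallyLipschitzOn.exists_lipschitzOnWith_of_compact hK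
  obtain ⟨B, hB⟩ := hK.exists_bound_of_continuousOn hF.continuous.continuousOn
  -- The field is bounded on `K`, so the solution is Lipschitz in time, and so are the acceleration
  -- and the dissipation bound to which the Barbalat lemmas apply.
  have hxL : LipschitzOnWith B.toNNReal x (Ici 0) :=
    (convex_Ici 0).lipschitzOnWith_of_nnnorm_hasDerivWithin_le hx fun t ht => by
      rw [← NNReal.coe_le_coe]
      exact (hB _ (hxK t ht)).trans (Real.le_coe_toNNReal B)
  have hFx : LipschitzOnWith (C * B.toNNReal) (fun t => N.closedLoop S (x t)) (Ici 0) :=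
    hC.comp hxL hxK
  -- the frequencies converge
  have hφ : LocallyLipschitz fun y : GridState G => ∑ i, N.E i * (y.2 i - N.ωInf) ^ 2 := by
    refine LocallyLipschitz.real_sum _ fun i _ => (LocallyLipschitz.const _).real_mul ?_
    simp only [sq]
    have := (locallyLipschitz_freq (G := G) i).sub (LocallyLipschitz.const N.ωInf)
    exact this.real_mul this
  obtain ⟨C', hC'⟩ := hφ.locallyLipschitzOn.exists_lipschitzOnWith_of_compact hK
  obtain ⟨v, hv⟩ := (antitoneOn_energy hlam hω (convex_Ici 0) hx).tendsto_atTop_of_bddBelow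
    fun t ht => energy_nonneg hlam (hKΓ _ (hxK t ht))
  have hfreq : ∀ i, Tendsto (fun t => (x t).2 i) atTop (𝓝 N.ωInf) := by
    intro i
    rw [Metric.tendsto_nhds]
    intro ε hε
    have hpos : 0 < N.E i * ε ^ 2 := mul_pos (N.E_pos i) (by positivity)
    filter_upwards [eventually_lt_of_hasDerivWithinAt_of_tendsto
      (fun t ht => hasDerivWithinAt_energy hx ht) hv (hC'.comp hxL hxK)
      (fun t _ => energyRate_le hlam hω (x t)) hpos] with t ht
    have h1 := Finset.single_le_sum (f := fun i => N.E i * ((x t).2 i - N.ωInf) ^ 2)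
      (fun j _ => mul_nonneg (N.E_pos j).le (sq_nonneg _)) (Finset.mem_univ i)
    have h2 : N.E i * ((x t).2 i - N.ωInf) ^ 2 < N.E i * ε ^ 2 := h1.trans_lt ht
    rw [Real.dist_eq]
    exact abs_lt_of_sq_lt_sq (lt_of_mul_lt_mul_left h2 (N.E_pos i).le) hε.le
  -- the accelerations tend to zero
  have hacc : ∀ i, Tendsto (fun t => (N.closedLoop S (x t)).2 i) atTop (𝓝 0) := fun i =>
    tendsto_deriv_zero_of_tendsto (fun t ht => hasDerivWithinAt_freq hx ht i) (hfreq i)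
      (((LipschitzWith.eval i).comp LipschitzWith.prod_snd).lipschitzOnWith.comp hFx
        (mapsTo_univ _ _))
  refine hK.tendsto_nhds_of_unique_mapClusterPt
    ((eventually_ge_atTop 0).mono fun t ht => hxK t ht) fun y hy hcl => ?_
  have hy2 : ∀ i, y.2 i = N.ωInf := fun i =>
    hcl.eq_of_tendsto (φ := fun z : GridState G => z.2 i)
      (locallyLipschitz_freq i).continuous.continuousAt (hfreq i)
  have hyF : ∀ i, (N.closedLoop S y).2 i = 0 := fun i =>
    hcl.eq_of_tendsto (φ := fun z : GridState G => (N.closedLoop S z).2 i)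
      ((continuous_apply i).comp (continuous_snd.comp hF.continuous)).continuousAt (hacc i)
  have hflow : N.flow y.1 = N.flow lamInf := by
    rw [← hlam.balance]
    funext i
    have h1 := M_mul_closedLoop (N := N) (S := S) y i
    have h2 : (if i ∈ S.C then N.control S i y else 0) = 0 := by
      split_ifs with hi
      exacts [control_eq_zero (by rw [hy2]; exact hω i hi), rfl]
    rw [hyF, h2, hy2] at h1
    simp only [pTilde]
    linarith
  exact Prod.ext (eq_of_flow_eq (hKD y hy) hlam.mem_rangeD (hKΓ y hy)
    (N.Γ_subset_Γcl hlam.mem_Γ) hflow) (funext hy2)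

/-- Solutions that start in `Γ_cl` with energy below `c` stay in `Γ_cl`. -/
lemma mem_sublevel_of_isSolutionOn (hlam : N.IsEquilibriumAngle lamInf)
    (hω : ∀ i ∈ S.C, N.ωInf ∈ Ioo (S.loTh i) (S.hiTh i)) {T C : ℝ} (hT : 0 ≤ T)
    {x : ℝ → GridState G} (hx : IsSolutionOn (N.closedLoop S) (Icc 0 T) x)
    (h0 : (x 0).1 ∈ N.Γcl) (hC : N.energy lamInf (x 0) ≤ C) (hC' : C < N.cMin lamInf) :
    (x T).1 ∈ N.Γcl ∧ N.energy lamInf (x T) ≤ C := by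
  have hanti := antitoneOn_energy hlam hω (convex_Icc 0 T) hx
  refine ⟨?_, (hanti (left_mem_Icc.2 hT) (right_mem_Icc.2 hT) hT).trans hC⟩
  -- Only the angles need a barrier: the frontier of Γ_cl × ℝⁿ is ∂Γ_cl × ℝⁿ, where the energy is at
  -- least c.
  have h := mem_of_antitoneOn_of_frontier (S := N.Γcl ×ˢ (univ : Set (ι → ℝ))) hT
    hx.continuousOn hanti (c := N.cMin lamInf) (fun y hy => ?_) ⟨h0, mem_univ _⟩
    (hC.trans_lt hC')
  · exact h.1
  · rw [frontier_prod_univ_eq] at hy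
    exact cMin_le_energy hlam hy.1

lemma isLyapunovStable_equilibrium (hlam : N.IsEquilibriumAngle lamInf)
    (hω : ∀ i ∈ S.C, N.ωInf ∈ Ioo (S.loTh i) (S.hiTh i)) :
    IsLyapunovStable (N.closedLoop S) (N.equilibrium lamInf) := by
  refine ⟨closedLoop_equilibrium hlam hω, fun U hU => ?_⟩
  have hΓ : {x : GridState G | x.1 ∈ N.Γ} ∈ 𝓝 (N.equilibrium lamInf) :=
    (N.isOpen_Γ.preimage continuous_fst).mem_nhds hlam.mem_Γ
  -- The ball is also kept inside Γ, where the energy is positive off the equilibrium; its minimum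
  -- on the sphere is then a barrier. Membership in range D plays no role here.
  obtain ⟨r, hr, hrU⟩ := Metric.nhds_basis_closedBall.mem_iff.1 (inter_mem hU hΓ)
  obtain ⟨m, hm, hmin⟩ : ∃ m > 0, ∀ y ∈ Metric.sphere (N.equilibrium lamInf) r,
      m ≤ N.energy lamInf y := by
    rcases (Metric.sphere (N.equilibrium lamInf) r).eq_empty_or_nonempty with he | hne
    · exact ⟨1, one_pos, by simp [he]⟩
    · obtain ⟨y, hy, hmin⟩ := (isCompact_sphere _ _).exists_isMinOn hne
        (N.continuous_energy lamInf).continuousOn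
      refine ⟨_, energy_pos hlam (N.Γ_subset_Γcl (hrU (Metric.sphere_subset_closedBall hy)).2) ?_,
        fun z hz => hmin hz⟩
      rintro rfl
      rw [Metric.mem_sphere, dist_self] at hy
      exact hr.ne hy
  have htrap : ∀ x₀ ∈ Metric.ball (N.equilibrium lamInf) r ∩ {y | N.energy lamInf y < m},
      ∀ T : ℝ, 0 ≤ T → ∀ x : ℝ → GridState G, IsSolutionOn (N.closedLoop S) (Icc 0 T) x →
      x 0 = x₀ → x T ∈ Metric.closedBall (N.equilibrium lamInf) r := by
    intro x₀ hx₀ T hT x hx h0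
    refine mem_of_antitoneOn_of_frontier hT hx.continuousOn
      (antitoneOn_energy hlam hω (convex_Icc 0 T) hx) (c := m)
      (fun y hy => hmin y (Metric.frontier_closedBall_subset_sphere hy)) ?_ ?_
    · rw [h0]; exact Metric.ball_subset_closedBall hx₀.1
    · rw [h0]; exact hx₀.2
  refine ⟨Metric.ball (N.equilibrium lamInf) r ∩ {y | N.energy lamInf y < m},
    inter_mem (Metric.ball_mem_nhds _ hr) ?_, fun x₀ hx₀ => ⟨?_, fun x hx h0 t ht => ?_⟩⟩
  · exact (isOpen_lt (N.continuous_energy lamInf) continuous_const).mem_nhds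
      (by rw [mem_ofPred_eq, energy_equilibrium]; exact hm)
  · exact exists_isSolutionOn_Ici_of_trapped (N.locallyLipschitz_closedLoop S)
      (isCompact_closedBall (N.equilibrium lamInf) r) (Metric.ball_subset_closedBall hx₀.1)
      (htrap x₀ hx₀)
  · exact (hrU (htrap x₀ hx₀ t ht x (hx.mono Icc_subset_Ici_self) h0)).1

end PowerNetwork

/-! ### Frequency invariance and attraction. -/

lemma infDist_Icc {a b : ℝ} (hab : a ≤ b) (z : ℝ) :
    Metric.infDist z (Icc a b) = max (z - b) 0 + max (-z - -a) 0 := by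
  have hne : (Icc a b).Nonempty := nonempty_Icc.2 hab
  have hle : ∀ w ∈ Icc a b, Metric.infDist z (Icc a b) ≤ |z - w| := fun w hw =>
    Metric.infDist_le_dist_of_mem hw
  rcases lt_or_ge z a with h1 | h1
  · rw [max_eq_right (by linarith), max_eq_left (by linarith)]
    refine le_antisymm ?_ ((Metric.le_infDist hne).2 fun w hw => ?_)
    · have := hle a ⟨le_rfl, hab⟩
      rw [abs_of_neg (by linarith)] at this
      linarith
    · rw [Real.dist_eq, abs_sub_comm]
      linarith [le_abs_self (w - z), hw.1]
  · rcases lt_or_ge b z with h2 | h2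
    · rw [max_eq_left (by linarith), max_eq_right (by linarith)]
      refine le_antisymm ?_ ((Metric.le_infDist hne).2 fun w hw => ?_)
      · have := hle b ⟨hab, le_rfl⟩
        rw [abs_of_pos (by linarith)] at this
        linarith
      · rw [Real.dist_eq]
        linarith [le_abs_self (z - w), hw.2]
    · rw [max_eq_right (by linarith), max_eq_right (by linarith),
        Metric.infDist_zero_of_mem (mem_Icc.2 ⟨h1, h2⟩), add_zero]

/-- The excess over `h` of a quantity that the upper controller acts on. -/
lemma excess_of_deriv_le {f f' : ℝ → ℝ} {h hth m : ℝ} {α : ℝ → ℝ} (hα : IsClassK α)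
    (hh : hth < h) (hm : 0 < m)
    (hf : ∀ t ∈ Ici (0 : ℝ), HasDerivWithinAt f (f' t) (Ici 0) t)
    (hle : ∀ t ∈ Ici (0 : ℝ), hth < f t → m * f' t ≤ -α (f t - h) / (f t - hth)) :
    AntitoneOn (fun t => max (f t - h) 0) (Ici 0) ∧
      Tendsto (fun t => max (f t - h) 0) atTop (𝓝 0) := by
  have hαpos : ∀ s, 0 < s → 0 < α s := fun s hs => hα.map_zero ▸ hα.strictMono hs
  have hneg : ∀ t ∈ Ici (0 : ℝ), h < f t → f' t < 0 := by
    intro t ht hlt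
    have h1 : -α (f t - h) / (f t - hth) < 0 :=
      div_neg_of_neg_of_pos (neg_lt_zero.2 (hαpos _ (sub_pos.2 hlt))) (by linarith)
    exact neg_of_mul_neg_right ((hle t ht (hh.trans hlt)).trans_lt h1) hm.le
  refine ⟨antitoneOn_max_sub_zero hf hneg, tendsto_max_sub_zero hf hneg fun ε hε => ?_⟩
  have hB : 0 < max (f 0) h - hth := by linarith [le_max_right (f 0) h]
  -- While `h + ε ≤ f t ≤ max (f 0) h`, the numerator is at least `α ε` and the denominator at most
  -- its value at the upper end.
  refine ⟨α ε / (max (f 0) h - hth) / m, div_pos (div_pos (hαpos ε hε) hB) hm,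
    fun t ht h1 h2 => ?_⟩
  have h3 := hle t ht (by linarith)
  have h4 : α ε / (max (f 0) h - hth) ≤ α (f t - h) / (f t - hth) :=
    div_le_div₀ (hαpos _ (by linarith)).le (hα.strictMono.monotone (by linarith))
      (by linarith) (by linarith)
  rw [← neg_div, le_div_iff₀ hm]
  rw [neg_div] at h3
  linarith

namespace PowerNetwork

variable {ι : Type*} [Fintype ι] [DecidableEq ι] {G : SimpleGraph ι} [DecidableRel G.Adj]
  {N : PowerNetwork G} {S : FrequencySpec ι} {lamInf : G.edgeSet → ℝ}

lemma M_mul_closedLoop_eq_control_sub_q {i : ι} (hi : i ∈ S.C) (x : GridState G) :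
    N.M i * (N.closedLoop S x).2 i = N.control S i x - N.q i x := by
  rw [M_mul_closedLoop, if_pos hi, q]
  ring

lemma upper_excess {x : ℝ → GridState G} (hx : IsSolutionOn (N.closedLoop S) (Ici 0) x) {i : ι}
    (hi : i ∈ S.C) : AntitoneOn (fun t => max ((x t).2 i - S.hi i) 0) (Ici 0) ∧
      Tendsto (fun t => max ((x t).2 i - S.hi i) 0) atTop (𝓝 0) := by
  refine excess_of_deriv_le (S.classK_αhi i hi) (S.hiTh_lt_hi i hi) (N.M_pos i)
    (fun t ht => hasDerivWithinAt_freq hx ht i) fun t _ hlt => ?_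
  rw [M_mul_closedLoop_eq_control_sub_q hi, control, if_pos hlt]
  linarith [min_le_right 0
    (-S.αhi i ((x t).2 i - S.hi i) / ((x t).2 i - S.hiTh i) + N.q i (x t))]

/-- The reflection ω ↦ -ω turns the lower controller into an upper one with bound `-lo` and
threshold `-loTh`. -/
lemma lower_excess {x : ℝ → GridState G} (hx : IsSolutionOn (N.closedLoop S) (Ici 0) x) {i : ι}
    (hi : i ∈ S.C) : AntitoneOn (fun t => max (-(x t).2 i - -S.lo i) 0) (Ici 0) ∧
      Tendsto (fun t => max (-(x t).2 i - -S.lo i) 0) atTop (𝓝 0) := by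
  refine excess_of_deriv_le (S.classK_αlo i hi) (neg_lt_neg (S.lo_lt_loTh i hi)) (N.M_pos i)
    (fun t ht => (hasDerivWithinAt_freq hx ht i).neg) fun t _ hlt => ?_
  have hlt' : (x t).2 i < S.loTh i := by simpa using hlt
  have hth := S.loTh_lt_hiTh i hi
  rw [mul_neg, M_mul_closedLoop_eq_control_sub_q hi, control, if_neg (by linarith), if_pos hlt',
    show -(x t).2 i - -S.lo i = S.lo i - (x t).2 i by ring,
    show -(x t).2 i - -S.loTh i = S.loTh i - (x t).2 i by ring, neg_div]
  linarith [le_max_right 0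
    (S.αlo i (S.lo i - (x t).2 i) / (S.loTh i - (x t).2 i) + N.q i (x t))]

omit [Fintype ι] [DecidableEq ι] in
lemma lo_le_hi {i : ι} (hi : i ∈ S.C) : S.lo i ≤ S.hi i :=
  ((S.lo_lt_loTh i hi).trans ((S.loTh_lt_hiTh i hi).trans (S.hiTh_lt_hi i hi))).le

lemma monotonicallyApproaches_freq {x : ℝ → GridState G}
    (hx : IsSolutionOn (N.closedLoop S) (Ici 0) x) {i : ι} (hi : i ∈ S.C) :
    MonotonicallyApproaches (fun t => (x t).2 i) (S.lo i) (S.hi i) := by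
  have h1 := upper_excess hx hi
  have h2 := lower_excess hx hi
  unfold MonotonicallyApproaches
  -- The distance is the excess above plus the excess below, and each is nonincreasing and tends to
  -- zero.
  simp only [infDist_Icc (lo_le_hi hi)]
  exact ⟨h1.1.add h2.1, by simpa using h1.2.add h2.2⟩

lemma freq_mem_Icc {x : ℝ → GridState G} (hx : IsSolutionOn (N.closedLoop S) (Ici 0) x) {i : ι}
    (hi : i ∈ S.C) (h0 : (x 0).2 i ∈ Icc (S.lo i) (S.hi i)) {t : ℝ} (ht : 0 ≤ t) :
    (x t).2 i ∈ Icc (S.lo i) (S.hi i) := by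
  have h1 := (le_max_left _ _).trans ((upper_excess hx hi).1 (mem_Ici.2 le_rfl) ht ht)
  have h2 := (le_max_left _ _).trans ((lower_excess hx hi).1 (mem_Ici.2 le_rfl) ht ht)
  simp only at h1 h2
  rw [max_eq_right (by linarith [h0.2])] at h1
  rw [max_eq_right (by linarith [h0.1])] at h2
  exact ⟨by linarith, by linarith⟩

end PowerNetwork

/-! ### Assembly of the theorem. -/

lemma SimpleGraph.Connected.nonempty_edgeSet {ι : Type*} [Nontrivial ι] {G : SimpleGraph ι}
    (hG : G.Connected) : Nonempty G.edgeSet := by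
  obtain ⟨i⟩ := hG.nonempty
  obtain ⟨j, hij⟩ := hG.preconnected.exists_adj_of_nontrivial i
  exact ⟨⟨s(i, j), hij⟩⟩

theorem mainTheorem1 {ι : Type*} [Fintype ι] [DecidableEq ι] [Nontrivial ι]
    (G : SimpleGraph ι) [DecidableRel G.Adj] (hG : G.Connected)
    (N : PowerNetwork G) (S : FrequencySpec ι)
    (lamInf : G.edgeSet → ℝ) (hlam : N.IsEquilibriumAngle lamInf)
    (hω : ∀ i ∈ S.C, N.ωInf ∈ Set.Ioo (S.loTh i) (S.hiTh i)) :
    -- initial states in the region `Φ`, for an arbitrary `β > 1`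
    (∀ β : ℝ, 1 < β → ∀ x₀ : GridState G, x₀.1 ∈ N.rangeD → x₀ ∈ N.Φ lamInf β →
      ∃ x : ℝ → GridState G,
        -- existence and uniqueness of the solution
        IsSolutionOn (N.closedLoop S) (Set.Ici 0) x ∧ x 0 = x₀ ∧
        (∀ (T : ℝ) (y : ℝ → GridState G),
          IsSolutionOn (N.closedLoop S) (Set.Ico 0 T) y → y 0 = x₀ →
            Set.EqOn y x (Set.Ico 0 T)) ∧
        -- invariance of `Φ` and of the range of `D`
        (∀ t, 0 ≤ t → (x t).1 ∈ N.rangeD ∧ x t ∈ N.Φ lamInf β) ∧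
        -- convergence
        Filter.Tendsto x Filter.atTop (nhds (N.equilibrium lamInf)) ∧
        -- the controllers become inactive in finite time
        (∃ t₀ : ℝ, 0 < t₀ ∧ ∀ t, t₀ ≤ t → ∀ i ∈ S.C, N.control S i (x t) = 0) ∧
        -- frequency invariance
        (∀ i ∈ S.C, (x 0).2 i ∈ Set.Icc (S.lo i) (S.hi i) →
          ∀ t, 0 < t → (x t).2 i ∈ Set.Icc (S.lo i) (S.hi i)) ∧
        -- frequency attraction
        (∀ i ∈ S.C, (x 0).2 i ∉ Set.Icc (S.lo i) (S.hi i) →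
          MonotonicallyApproaches (fun t => (x t).2 i) (S.lo i) (S.hi i) ∧
          ∃ t₁ : ℝ, 0 < t₁ ∧ ∀ t, t₁ ≤ t → (x t).2 i ∈ Set.Icc (S.lo i) (S.hi i))) ∧
    -- stability of the equilibrium
    IsLyapunovStable (N.closedLoop S) (N.equilibrium lamInf) ∧
    -- arbitrary initial states, in `Φ` or not, whose solution exists for all `t ≥ 0`
    (∀ x : ℝ → GridState G, IsSolutionOn (N.closedLoop S) (Set.Ici 0) x →
      (∀ i ∈ S.C, (x 0).2 i ∈ Set.Icc (S.lo i) (S.hi i) →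
        ∀ t, 0 < t → (x t).2 i ∈ Set.Icc (S.lo i) (S.hi i)) ∧
      (∀ i ∈ S.C, (x 0).2 i ∉ Set.Icc (S.lo i) (S.hi i) →
        MonotonicallyApproaches (fun t => (x t).2 i) (S.lo i) (S.hi i))) := by 
  have := hG.nonempty_edgeSet
  refine ⟨fun β hβ x₀ hx₀D hx₀Φ => ?_, PowerNetwork.isLyapunovStable_equilibrium hlam hω,
    fun x hx => ⟨fun i hi h0 t ht => PowerNetwork.freq_mem_Icc hx hi h0 ht.le,
      fun i hi _ => PowerNetwork.monotonicallyApproaches_freq hx hi⟩⟩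
  have hF := N.locallyLipschitz_closedLoop S
  have hc : N.cMin lamInf / β < N.cMin lamInf := div_lt_self (PowerNetwork.cMin_pos hlam) hβ
  have htrap : ∀ T : ℝ, 0 ≤ T → ∀ x : ℝ → GridState G,
      IsSolutionOn (N.closedLoop S) (Set.Icc 0 T) x → x 0 = x₀ → x T ∈ N.Φ lamInf β :=
    fun T hT x hx h0 => PowerNetwork.mem_sublevel_of_isSolutionOn hlam hω hT hx
      (h0 ▸ hx₀Φ.1) (h0 ▸ hx₀Φ.2) hc
  have hΦ : IsCompact (N.Φ lamInf β) := PowerNetwork.isCompact_sublevel hlam _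
  obtain ⟨x, hx, h0⟩ := exists_isSolutionOn_Ici_of_trapped hF hΦ hx₀Φ htrap
  have hinv : ∀ t, 0 ≤ t → (x t).1 ∈ N.rangeD ∧ x t ∈ N.Φ lamInf β := fun t ht =>
    ⟨PowerNetwork.mem_rangeD_of_isSolutionOn ht (hx.mono Set.Icc_subset_Ici_self) (h0 ▸ hx₀D),
      htrap t ht x (hx.mono Set.Icc_subset_Ici_self) h0⟩
  -- The compact set is Φ_β intersected with the closed condition that the angles lie in range D.
  have hlim : Filter.Tendsto x Filter.atTop (nhds (N.equilibrium lamInf)) :=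
    PowerNetwork.tendsto_equilibrium hlam hω
      (hΦ.inter_right (N.isClosed_rangeD.preimage continuous_fst))
      (fun y hy => hy.1.1) (fun y hy => hy.2) hx fun t ht => ⟨(hinv t ht).2, (hinv t ht).1⟩
  have hfreq : ∀ i, Filter.Tendsto (fun t => (x t).2 i) Filter.atTop (nhds N.ωInf) := fun i =>
    ((PowerNetwork.locallyLipschitz_freq (G := G) i).continuous.tendsto _).comp hlim
  have heventually : ∀ P : ℝ → Prop, (∀ᶠ t in Filter.atTop, P t) →
      ∃ t₀ : ℝ, 0 < t₀ ∧ ∀ t, t₀ ≤ t → P t := by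
    intro P hP
    obtain ⟨t₀, ht₀⟩ := Filter.eventually_atTop.1 hP
    exact ⟨max t₀ 1, lt_max_of_lt_right one_pos, fun t ht => ht₀ t ((le_max_left _ _).trans ht)⟩
  refine ⟨x, hx, h0, fun T y hy hy0 t ht => ?_, hinv, hlim, heventually _ ?_,
    fun i hi hi0 t ht => PowerNetwork.freq_mem_Icc hx hi hi0 ht.le,
    fun i hi _ => ⟨PowerNetwork.monotonicallyApproaches_freq hx hi, heventually _ ?_⟩⟩
  · exact IsSolutionOn.eqOn_Icc hF (hy.mono fun s hs => ⟨hs.1, hs.2.trans_lt ht.2⟩)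
      (hx.mono Set.Icc_subset_Ici_self) (hy0.trans h0.symm) ⟨ht.1, le_rfl⟩
  · refine (Filter.eventually_all_finset S.C).2 fun i hi => ?_
    exact ((hfreq i).eventually (Ioo_mem_nhds (hω i hi).1 (hω i hi).2)).mono
      fun t ht => PowerNetwork.control_eq_zero ht
  -- ω^∞ is interior to the safe interval, so convergence brings the frequency inside in finite
  -- time.
  · exact (hfreq i).eventually (Icc_mem_nhds ((S.lo_lt_loTh i hi).trans (hω i hi).1)
      ((hω i hi).2.trans (S.hiTh_lt_hi i hi)))
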